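/- Let $n\ge 2$, $1\le k\le n-1$, and let $\rho$ be one of the following probability densities on $\mathbb{R}^n$: (1) the uniform density on a nonempty, open, bounded, convex set; (2) the density of the standard normal distribution $\mathcal N(0,I)$. Put $\mathcal X=\{\rho>0\}$. Then there is a constant $C>0$, depending only on $\rho$ and $k$, such that the following holds. Let $f(x)=\tfrac12\|\Gamma^{-1/2}(d-\mathcal G(x))\|^2$ be a data misfit function, with $d\in\mathbb{R}^q$, $\mathcal G:\mathcal X\to\mathbb{R}^q$ and $\Gamma\in\mathbb{R}^{q\times q}$ symmetric positive definite. Assume that $f$ is measurable on $\mathcal X$ and has partial derivatives everywhere on $\mathcal X$ that are square integrable with respect to $\rho$. Let $$\int_{\mathcal X}\nabla f(x)\nabla f(x)^\top\rho(x)\,dx=W\operatorname{diag}(\lambda_1,\dots,\lambda_n)W^\top,\qquad \lambda_1\ge\dots\ge\lambda_n,$$ with $W$ orthogonal, and let $\hat W=[\hat W_1\ \hat W_2]$ be an orthogonal matrix, with $\hat W_1\in\mathbb{R}^{n\times k}$ and $\hat W_2\in\mathbb{R}^{n\times(n-k)}$, such that $\|W-\hat W\|\le\varepsilon$ in the spectral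 norm, for some $\varepsilon>0$. For $y\in\hat{\mathcal Y}=\hat W_1^\top\mathcal X$ let $\mathbb P^{y}$ be the distribution on $\mathbb{R}^{n-k}$ with density $z\mapsto\rho(\hat W_1y+\hat W_2z)/\int\rho(\hat W_1y+\hat W_2z')\,dz'$. Let $N\ge1$ and let $\hat Z^{y}_1,\dots,\hat Z^{y}_N$ ($y\in\hat{\mathcal Y}$) be random variables on a probability space $(\Omega,\mathcal A,\mathbb P)$ such that, for each $y$, they are independent with law $\mathbb P^{y}$, and such that each $(y,\omega)\mapsto\hat Z^{y}_j(\omega)$ is product measurable. Define $$\hat g_N(y,\omega)=\frac1N\sum_{j=1}^N f\bigl(\hat W_1y+\hat W_2\hat Z^{y}_j(\omega)\bigr),$$ $$\rho_{\mathrm{post}}(x)=\frac{e^{-f(x)}\rho(x)}{Z},\qquad Z=\int_{\mathcal X} e^{-f}\rho\,dx,\qquad \rho_{\mathrm{post},\hat g_N}(x,\omega)=\frac{e^{-\hat g_N(\hat W_1^\top x,\omega)}\rho(x)}{\int_{\mathcal X} e^{-\hat g_N(\hat W_1^\top x',\omega)}\rho(x')\,dx'},$$ and let $d_{\mathrm H}(p,q)=\bigl(\tfrac12\int(\sqrt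 p-\sqrt q)^2\,dx\bigr)^{1/2}$ be the Hellinger distance. Then $f\rho$ is integrable on $\mathcal X$, the random variable $\omega\mapsto d_{\mathrm H}(\rho_{\mathrm{post}},\rho_{\mathrm{post},\hat g_N}(\cdot,\omega))$ is integrable, and $$\mathbb E\bigl[d_{\mathrm H}(\rho_{\mathrm{post}},\rho_{\mathrm{post},\hat g_N})\bigr]\le\sqrt{C}\,L\,\bigl(1+N^{-1/2}\bigr)\Bigl(\varepsilon(\lambda_1+\dots+\lambda_k)^{1/2}+(\lambda_{k+1}+\dots+\lambda_n)^{1/2}\Bigr),$$ where $L>0$ is given by $L^2=\tfrac18\bigl(Z\exp(-\int_{\mathcal X}f\rho\,dx)\bigr)^{-1/2}$. -/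

import Mathlib

open MeasureTheory ProbabilityTheory
open scoped Matrix

namespace ActiveSubspace

noncomputable section

/-! ### Prior densities -/

/-- The set `𝒳 = {x | ρ x > 0}` on which a density is positive. -/
def posSet {n : ℕ} (ρ : EuclideanSpace ℝ (Fin n) → ℝ) : Set (EuclideanSpace ℝ (Fin n)) :=
  {x | 0 < ρ x}

/-- The density of the uniform distribution on `S`, vanishing off `S`. -/
def uniformDensity {n : ℕ} (S : Set (EuclideanSpace ℝ (Fin n))) :
    EuclideanSpace ℝ (Fin n) → ℝ :=
  S.indicator (fun _ => (volume.real S)⁻¹)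

/-- The density of the standard normal distribution `𝒩(0, I)` on `ℝⁿ`. -/
def stdGaussianDensity (n : ℕ) : EuclideanSpace ℝ (Fin n) → ℝ :=
  fun x => (√(2 * Real.pi) ^ n)⁻¹ * Real.exp (-‖x‖ ^ 2 / 2)

/-- The two admissible priors: the uniform distribution on a bounded convex (nonempty, open) set,
and the standard normal distribution. -/
def IsAdmissiblePrior {n : ℕ} (ρ : EuclideanSpace ℝ (Fin n) → ℝ) : Prop :=
  (∃ S : Set (EuclideanSpace ℝ (Fin n)), IsOpen S ∧ S.Nonempty ∧ Bornology.IsBounded S ∧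
      Convex ℝ S ∧ ρ = uniformDensity S) ∨
    ρ = stdGaussianDensity n

/-! ### The function of interest and its averaged gradient outer product -/

/-- The data misfit `x ↦ ½ ‖Γ^{-1/2} (d - 𝒢 x)‖² = ½ (d - 𝒢 x)ᵀ Γ⁻¹ (d - 𝒢 x)`. -/
def dataMisfit {n q : ℕ} (Γ : Matrix (Fin q) (Fin q) ℝ) (d : Fin q → ℝ)
    (G : EuclideanSpace ℝ (Fin n) → Fin q → ℝ) (x : EuclideanSpace ℝ (Fin n)) : ℝ :=
  1 / 2 * ((d - G x) ⬝ᵥ (Γ⁻¹ *ᵥ (d - G x)))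

/-- The `i`-th partial derivative. -/
def partialDeriv {n : ℕ} (f : EuclideanSpace ℝ (Fin n) → ℝ) (i : Fin n)
    (x : EuclideanSpace ℝ (Fin n)) : ℝ :=
  lineDeriv ℝ f x (EuclideanSpace.single i 1)

/-- `f` has all partial derivatives at every point of `{ρ > 0}`, and they are square integrable
with respect to `ρ`. -/
def HasSqIntegrablePartials {n : ℕ} (ρ f : EuclideanSpace ℝ (Fin n) → ℝ) : Prop :=
  ∀ i : Fin n,
    (∀ x ∈ posSet ρ, LineDifferentiableAt ℝ f x (EuclideanSpace.single i 1)) ∧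
      IntegrableOn (fun x => partialDeriv f i x ^ 2 * ρ x) (posSet ρ)

/-- The matrix `C = ∫_𝒳 ∇f(x) ∇f(x)ᵀ ρ(x) dx`. -/
def gradOuterProduct {n : ℕ} (ρ f : EuclideanSpace ℝ (Fin n) → ℝ) : Matrix (Fin n) (Fin n) ℝ :=
  Matrix.of fun i j => ∫ x in posSet ρ, partialDeriv f i x * partialDeriv f j x * ρ x

/-! ### Active and inactive variables

Throughout `n = k + m`, the first `k` columns of `W` span the active subspace and the last `m`
columns the inactive one. -/

/-- `W₁`, the first `k` columns of `W`. -/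
def activeCols {k m : ℕ} (W : Matrix (Fin (k + m)) (Fin (k + m)) ℝ) :
    Matrix (Fin (k + m)) (Fin k) ℝ :=
  W.submatrix id (Fin.castAdd m)

/-- `W₂`, the last `m` columns of `W`. -/
def inactiveCols {k m : ℕ} (W : Matrix (Fin (k + m)) (Fin (k + m)) ℝ) :
    Matrix (Fin (k + m)) (Fin m) ℝ :=
  W.submatrix id (Fin.natAdd k)

/-- The active variable `y = W₁ᵀ x`. -/
def activeVar {k m : ℕ} (W : Matrix (Fin (k + m)) (Fin (k + m)) ℝ)
    (x : EuclideanSpace ℝ (Fin (k + m))) : EuclideanSpace ℝ (Fin k) :=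
  WithLp.toLp 2 ((activeCols W)ᵀ *ᵥ x.ofLp)

/-- The point `W₁ y + W₂ z`. -/
def point {k m : ℕ} (W : Matrix (Fin (k + m)) (Fin (k + m)) ℝ)
    (y : EuclideanSpace ℝ (Fin k)) (z : EuclideanSpace ℝ (Fin m)) :
    EuclideanSpace ℝ (Fin (k + m)) :=
  WithLp.toLp 2 (activeCols W *ᵥ y.ofLp + inactiveCols W *ᵥ z.ofLp)

/-- The domain `𝒴 = W₁ᵀ 𝒳` of the active variable. -/
def activeDomain {k m : ℕ} (ρ : EuclideanSpace ℝ (Fin (k + m)) → ℝ)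
    (W : Matrix (Fin (k + m)) (Fin (k + m)) ℝ) : Set (EuclideanSpace ℝ (Fin k)) :=
  activeVar W '' posSet ρ

/-- The marginal density `ρ_Y(y) = ∫ ρ(W₁ y + W₂ z) dz`. -/
def marginalDensity {k m : ℕ} (ρ : EuclideanSpace ℝ (Fin (k + m)) → ℝ)
    (W : Matrix (Fin (k + m)) (Fin (k + m)) ℝ) (y : EuclideanSpace ℝ (Fin k)) : ℝ :=
  ∫ z : EuclideanSpace ℝ (Fin m), ρ (point W y z)

/-- The conditional density `ρ_{Z|Y}(z|y) = ρ(W₁ y + W₂ z) / ρ_Y(y)`; it is `0` when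
`ρ_Y(y) = 0`. -/
def condDensity {k m : ℕ} (ρ : EuclideanSpace ℝ (Fin (k + m)) → ℝ)
    (W : Matrix (Fin (k + m)) (Fin (k + m)) ℝ) (y : EuclideanSpace ℝ (Fin k))
    (z : EuclideanSpace ℝ (Fin m)) : ℝ :=
  ρ (point W y z) / marginalDensity ρ W y

/-- The conditional distribution of the inactive variable given the active variable `y`. -/
def condLaw {k m : ℕ} (ρ : EuclideanSpace ℝ (Fin (k + m)) → ℝ)
    (W : Matrix (Fin (k + m)) (Fin (k + m)) ℝ) (y : EuclideanSpace ℝ (Fin k)) :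
    Measure (EuclideanSpace ℝ (Fin m)) :=
  volume.withDensity fun z => ENNReal.ofReal (condDensity ρ W y z)

/-- `Z j y ω` is the `j`-th Monte Carlo sample at the active coordinate `y`: for every `y` in the
active domain the samples `Z j y`, `j < N`, are independent with the conditional law given `y`,
and each map `(y, ω) ↦ Z j y ω` is product measurable. -/
structure IsConditionalSample {k m N : ℕ} {Ω : Type*} [MeasurableSpace Ω] (P : Measure Ω)
    (ρ : EuclideanSpace ℝ (Fin (k + m)) → ℝ) (W : Matrix (Fin (k + m)) (Fin (k + m)) ℝ)
    (Z : Fin N → EuclideanSpace ℝ (Fin k) → Ω → EuclideanSpace ℝ (Fin m)) : Prop where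
  measurable : ∀ j, Measurable fun p : activeDomain ρ W × Ω => Z j p.1 p.2
  indep : ∀ y ∈ activeDomain ρ W, iIndepFun (fun j => Z j y) P
  law : ∀ y ∈ activeDomain ρ W, ∀ j, P.map (Z j y) = condLaw ρ W y

/-- The Monte Carlo approximation `x ↦ g_N(W₁ᵀ x, ω)` of `f`, where
`g_N(y, ω) = N⁻¹ ∑ⱼ f(W₁ y + W₂ Zⱼ^y(ω))`. -/
def monteCarloApprox {k m N : ℕ} {Ω : Type*} (f : EuclideanSpace ℝ (Fin (k + m)) → ℝ)
    (W : Matrix (Fin (k + m)) (Fin (k + m)) ℝ)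
    (Z : Fin N → EuclideanSpace ℝ (Fin k) → Ω → EuclideanSpace ℝ (Fin m)) (ω : Ω)
    (x : EuclideanSpace ℝ (Fin (k + m))) : ℝ :=
  (N : ℝ)⁻¹ * ∑ j : Fin N, f (point W (activeVar W x) (Z j (activeVar W x) ω))

/-! ### Posteriors and the Hellinger distance -/

/-- The normalizing constant `∫ exp(-h) ρ`. -/
def normConst {n : ℕ} (ρ h : EuclideanSpace ℝ (Fin n) → ℝ) : ℝ :=
  ∫ x, Real.exp (-h x) * ρ x

/-- The posterior density `exp(-h) ρ / ∫ exp(-h) ρ` with prior `ρ` and negative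
log-likelihood `h`. -/
def posterior {n : ℕ} (ρ h : EuclideanSpace ℝ (Fin n) → ℝ) (x : EuclideanSpace ℝ (Fin n)) : ℝ :=
  Real.exp (-h x) * ρ x / normConst ρ h

/-- The Hellinger distance `(½ ∫ (√p - √q)²)^{1/2}` of two probability densities. -/
def hellingerDist {n : ℕ} (p q : EuclideanSpace ℝ (Fin n) → ℝ) : ℝ :=
  √(1 / 2 * ∫ x, (√(p x) - √(q x)) ^ 2)

/-- The constant `L`, given by `L² = ⅛ (Z exp(-∫_𝒳 f ρ))^{-1/2}` with `Z = ∫ exp(-f) ρ`. -/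
def hellingerConst {n : ℕ} (ρ f : EuclideanSpace ℝ (Fin n) → ℝ) : ℝ :=
  √(1 / 8 * (normConst ρ f * Real.exp (-∫ x in posSet ρ, f x * ρ x)) ^ (-(1 / 2) : ℝ))

end

end ActiveSubspace

open ActiveSubspace

open Filter Topology

/-! The Hellinger distance is at most `√8 * hellingerConst ρ f` times the `L²(ρ)` distance between
`f` and its Monte Carlo approximation (`hellingerDist_posterior_le`), so by Jensen for the square
root it suffices to bound the mean squared error. Cauchy–Schwarz over the samples bounds that error
by the average of the one-sample errors. These have a common expectation: the integral of `(f(y,z')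
- f(y,z))²` with `(y,z)` drawn from `ρ` and `z'` from the conditional law on the same slice
(`lintegral_sampleMean_le`).

What is needed is thus a Poincaré inequality on slices in doubled form
(`BridgeBound.lintegral_sq_sub_le`). Write the increment as an integral of the gradient along the
segment from `z` to `z'`, apply Cauchy–Schwarz with weight `√(s(1-s))`, and pass from the endpoints
to the point `q = z + s w` and the increment `w = z' - z`. There remains a second moment of `w`
given `q`. For a slice of a bounded convex set or of a standard Gaussian it is at most `C /
(s(1-s))` times the density at `q` and the total mass, with `C` uniform over all rotations and
slices (`exists_bridgeBound_slices`). Only the inactive part of the gradient enters. Its energy is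
`∑ λ_l ‖Ŵ₂ᵀ w_l‖²`, where the norm is at most `ε` for `l ≤ k`, since `Ŵ₂` annihilates the nearby
column of `Ŵ`, and at most `1` otherwise.

Two points need care. Existence of partial derivatives gives no fundamental theorem of calculus
along oblique segments. It is recovered weakly: for fixed `v` and almost every `x`, after a bounded
truncation of `f` (`ae_sub_eq_integral_inner`, `ae_ofReal_sub_sq_le_path`). Secondly, the
normalizing constant of the random approximation has no uniform lower bound, because its prior mean
may exceed that of `f`. When the excess is large the `L²(ρ)` distance exceeds `1`, and the trivial
bound `1` on the Hellinger distance suffices. -/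

/-! ### Weak derivatives and increments along segments -/

/-- Integration by parts holds in each coordinate direction, where a pointwise derivative exists,
and the weak gradient is linear in the direction. No pointwise derivative along `v` itself is
involved. Boundedness of `u` makes its products with `φ` and with the derivatives of `φ` integrable.
-/
theorem integral_mul_fderiv_eq_neg_inner {n : ℕ} {Ω : Set (EuclideanSpace ℝ (Fin n))}
    {u : EuclideanSpace ℝ (Fin n) → ℝ} (hu : Measurable u) {M : ℝ} (hM : ∀ x, |u x| ≤ M)
    {D : EuclideanSpace ℝ (Fin n) → EuclideanSpace ℝ (Fin n)}
    (hloc : ∀ K ⊆ Ω, IsCompact K → IntegrableOn D K)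
    (hder : ∀ x ∈ Ω, ∀ i, HasLineDerivAt ℝ u (D x i) x (EuclideanSpace.single i 1))
    {φ : EuclideanSpace ℝ (Fin n) → ℝ} (hφ : ContDiff ℝ 1 φ) (hc : HasCompactSupport φ)
    (hφΩ : tsupport φ ⊆ Ω) (v : EuclideanSpace ℝ (Fin n)) :
    ∫ x, u x * fderiv ℝ φ x v = -∫ x, inner ℝ (D x) v * φ x := by
  have hφc : Continuous φ := hφ.continuous
  have hDφ : ∀ i, Integrable (fun x => D x i * φ x) := by
    intro i
    have h1 : IntegrableOn (fun x => D x i) (tsupport φ) :=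
      (hloc _ hφΩ hc).eval_piLp i
    have h2 : IntegrableOn (fun x => D x i * φ x) (tsupport φ) :=
      h1.mul_continuousOn hφc.continuousOn hc
    refine (integrableOn_iff_integrable_of_support_subset ?_).1 h2
    intro x hx
    exact subset_tsupport φ fun h => hx (by simp [h])
  have hdc : ∀ w, Continuous fun x => fderiv ℝ φ x w := fun w =>
    (hφ.continuous_fderiv one_ne_zero).clm_apply continuous_const
  have hdi : ∀ w, Integrable fun x => u x * fderiv ℝ φ x w := by
    intro w
    refine ((hdc w).integrable_of_hasCompactSupport (hc.fderiv_apply ℝ w)).bdd_mul (c := M)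
      hu.aestronglyMeasurable (Filter.Eventually.of_forall fun x => ?_)
    exact hM x
  have hpart : ∀ i, ∫ x, u x * fderiv ℝ φ x (EuclideanSpace.single i 1) = -∫ x, D x i * φ x := by
    intro i
    refine integral_bilinear_hasLineDerivAt_right_eq_neg_left_of_integrable
      (B := ContinuousLinearMap.mul ℝ ℝ) (v := EuclideanSpace.single i 1) (hDφ i) (hdi _) ?_
      (fun x hx => hder x (hφΩ hx) i) ?_
    · refine (hφc.integrable_of_hasCompactSupport hc).bdd_mul (c := M)
        hu.aestronglyMeasurable (Filter.Eventually.of_forall fun x => hM x)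
    · exact fun x _ => ((hφ.differentiable one_ne_zero) x).hasFDerivAt.hasLineDerivAt _
  have hv : v = ∑ i, v i • EuclideanSpace.single i (1 : ℝ) := by
    ext j
    simp [Finset.sum_apply, Pi.single_apply]
  have e1 : ∀ x, u x * fderiv ℝ φ x v
      = ∑ i, v i * (u x * fderiv ℝ φ x (EuclideanSpace.single i 1)) := by
    intro x
    conv_lhs => rw [hv]
    rw [map_sum, Finset.mul_sum]
    refine Finset.sum_congr rfl fun i _ => ?_
    rw [map_smul, smul_eq_mul]; ring
  have e2 : ∀ x, inner ℝ (D x) v * φ x = ∑ i, v i * (D x i * φ x) := by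
    intro x
    simp only [PiLp.inner_apply, RCLike.inner_apply, conj_trivial, Finset.sum_mul]
    exact Finset.sum_congr rfl fun i _ => by ring
  simp only [e1, e2]
  rw [integral_finsetSum _ fun i _ => (hdi _).const_mul _,
    integral_finsetSum _ fun i _ => (hDφ i).const_mul _, ← Finset.sum_neg_distrib]
  refine Finset.sum_congr rfl fun i _ => ?_
  rw [integral_const_mul, integral_const_mul, hpart, mul_neg]

/-- By translation invariance the `L¹` norm in `x` is the same for every `s`, and `ν` is finite. -/
theorem integrable_comp_add_smul {E F : Type*} [NormedAddCommGroup E] [InnerProductSpace ℝ E]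
    [FiniteDimensional ℝ E] [MeasurableSpace E] [BorelSpace E] [NormedAddCommGroup F]
    {D : E → F} (hD : StronglyMeasurable D) (hi : Integrable D) (v : E) (ν : Measure ℝ)
    [IsFiniteMeasure ν] :
    Integrable (fun p : E × ℝ => D (p.1 + p.2 • v)) (volume.prod ν) := by
  have hm : StronglyMeasurable (fun p : E × ℝ => D (p.1 + p.2 • v)) :=
    hD.comp_measurable (by fun_prop)
  rw [integrable_prod_iff' hm.aestronglyMeasurable]
  refine ⟨Filter.Eventually.of_forall fun s => hi.comp_add_right (s • v), ?_⟩
  have : (fun s : ℝ => ∫ x, ‖D (x + s • v)‖) = fun _ => ∫ x, ‖D x‖ := by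
    ext s
    exact integral_add_right_eq_self (fun x => ‖D x‖) (s • v)
  simp only [this]
  exact integrable_const _

/-- Tested against `φ`, the increment of `u` becomes an increment of `φ`. The smooth `φ` obeys the
fundamental theorem of calculus, and integrating by parts for each `s` moves the derivative back to
`u`. -/
theorem ae_sub_eq_integral_inner {n : ℕ} {Ω : Set (EuclideanSpace ℝ (Fin n))} (hΩ : IsOpen Ω)
    (hconv : Convex ℝ Ω)
    {u : EuclideanSpace ℝ (Fin n) → ℝ} (hu : Measurable u) {M : ℝ} (hM : ∀ x, |u x| ≤ M)
    {D : EuclideanSpace ℝ (Fin n) → EuclideanSpace ℝ (Fin n)} (hD : Measurable D)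
    (hloc : ∀ K ⊆ Ω, IsCompact K → IntegrableOn D K)
    (hder : ∀ x ∈ Ω, ∀ i, HasLineDerivAt ℝ u (D x i) x (EuclideanSpace.single i 1))
    (v : EuclideanSpace ℝ (Fin n)) :
    ∀ᵐ x, x ∈ Ω → x + v ∈ Ω → u (x + v) - u x
      = ∫ s in Set.Ioc (0 : ℝ) 1, inner ℝ (D (x + s • v)) v := by
  set ν : Measure ℝ := volume.restrict (Set.Ioc (0 : ℝ) 1) with hν
  set U : Set (EuclideanSpace ℝ (Fin n)) := {x | x ∈ Ω ∧ x + v ∈ Ω} with hUdef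
  have hU : IsOpen U := hΩ.inter (hΩ.preimage (by fun_prop))
  have hseg : ∀ x ∈ U, ∀ s ∈ Set.Icc (0 : ℝ) 1, x + s • v ∈ Ω := by
    intro x hx s hs
    have := hconv hx.1 hx.2 (sub_nonneg.2 hs.2) hs.1 (by ring)
    convert this using 1
    module
  -- integrability along the segments over a compact set
  have key : ∀ K ⊆ U, IsCompact K → ∃ D' : EuclideanSpace ℝ (Fin n) → EuclideanSpace ℝ (Fin n),
      StronglyMeasurable D' ∧ Integrable D' ∧
        ∀ x ∈ K, ∀ s ∈ Set.Icc (0 : ℝ) 1, D' (x + s • v) = D (x + s • v) := by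
    intro K hKU hK
    set K' := (fun p : EuclideanSpace ℝ (Fin n) × ℝ => p.1 + p.2 • v) ''
      (K ×ˢ Set.Icc (0 : ℝ) 1) with hK'
    have hK'c : IsCompact K' := (hK.prod isCompact_Icc).image (by fun_prop)
    have hK'Ω : K' ⊆ Ω := by
      rintro _ ⟨p, hp, rfl⟩
      exact hseg _ (hKU hp.1) _ hp.2
    refine ⟨K'.indicator D, (hD.indicator hK'c.measurableSet).stronglyMeasurable,
      (integrable_indicator_iff hK'c.measurableSet).2 (hloc _ hK'Ω hK'c), fun x hx s hs => ?_⟩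
    exact Set.indicator_of_mem (Set.mem_image_of_mem _ (Set.mk_mem_prod hx hs)) _
  have hprod : ∀ K ⊆ U, IsCompact K → ∀ φ : EuclideanSpace ℝ (Fin n) → ℝ, Measurable φ →
      (∃ c, ∀ x, |φ x| ≤ c) → (∀ x ∉ K, φ x = 0) →
      Integrable (fun p : EuclideanSpace ℝ (Fin n) × ℝ => inner ℝ (D (p.1 + p.2 • v)) v * φ p.1)
        (volume.prod ν) := by
    rintro K hKU hK φ hφ ⟨c, hc⟩ h0
    obtain ⟨D', hD'm, hD'i, hD'⟩ := key K hKU hK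
    have h1 := integrable_comp_add_smul hD'm hD'i v ν
    have h2 : Integrable (fun p : EuclideanSpace ℝ (Fin n) × ℝ =>
        inner ℝ (D' (p.1 + p.2 • v)) v * φ p.1) (volume.prod ν) := by
      refine (h1.inner_const v).mul_bdd (c := c)
        (hφ.comp measurable_fst).aestronglyMeasurable (Filter.Eventually.of_forall fun p => hc _)
    refine h2.congr ?_
    have : ∀ᵐ p ∂(volume : Measure (EuclideanSpace ℝ (Fin n))).prod ν, p.2 ∈ Set.Ioc (0 : ℝ) 1 :=
      Measure.quasiMeasurePreserving_snd.ae
        (p := fun s => s ∈ Set.Ioc (0 : ℝ) 1) (ae_restrict_mem measurableSet_Ioc)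
    filter_upwards [this] with p hp
    by_cases hx : p.1 ∈ K
    · rw [hD' _ hx _ (Set.Ioc_subset_Icc_self hp)]
    · rw [h0 _ hx]; simp
  have hutrans : ∀ φ : EuclideanSpace ℝ (Fin n) → ℝ, Integrable φ → ∀ w,
      Integrable fun x => u (x + w) * φ x := by
    intro φ hφ w
    exact hφ.bdd_mul (c := M) (hu.comp (measurable_add_const w)).aestronglyMeasurable
      (Filter.Eventually.of_forall fun x => hM _)
  -- A locally integrable function on the open set `U` vanishes almost everywhere once all its
  -- integrals against smooth functions with compact support in `U` vanish.
  have main := hU.ae_eq_zero_of_integral_contDiff_smul_eq_zero (μ := volume)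
    (f := fun x => u (x + v) - u x - ∫ s, inner ℝ (D (x + s • v)) v ∂ν) ?_ ?_
  · filter_upwards [main] with x hx h1 h2
    exact sub_eq_zero.1 (hx ⟨h1, h2⟩)
  · refine (locallyIntegrableOn_iff hU.isLocallyClosed).2 fun K hKU hK => ?_
    have hφ : Measurable (K.indicator fun _ => (1 : ℝ)) := measurable_const.indicator hK.measurableSet
    have h1 := hprod K hKU hK (K.indicator fun _ => (1 : ℝ)) hφ
      ⟨1, fun x => by by_cases hx : x ∈ K <;> simp [hx]⟩ (fun x hx => by simp [hx])
    have h2 := h1.integral_prod_left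
    have hKf : IntegrableOn (fun _ : EuclideanSpace ℝ (Fin n) => (1 : ℝ)) K :=
      integrableOn_const hK.measure_lt_top.ne
    have h3 : IntegrableOn (fun x => u (x + v) - u x) K := by
      refine Integrable.sub ?_ ?_
      · simpa using hKf.bdd_mul (c := M)
          (hu.comp (measurable_add_const v)).aestronglyMeasurable
          (Filter.Eventually.of_forall fun x => hM _)
      · simpa using hKf.bdd_mul (c := M) hu.aestronglyMeasurable
          (Filter.Eventually.of_forall fun x => hM _)
    refine h3.sub ((h2.integrableOn (s := K)).congr_fun (fun x hx => ?_) hK.measurableSet)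
    simp [hx]
  · intro φ hφ hφc hφU
    have hφ1 : ContDiff ℝ 1 φ := hφ.of_le (by exact_mod_cast le_top)
    have hφcont := hφ.continuous
    obtain ⟨c, hc⟩ := hφc.exists_bound_of_continuous hφcont
    have hφi : Integrable φ := hφcont.integrable_of_hasCompactSupport hφc
    have hP := hprod (tsupport φ) hφU hφc φ hφcont.measurable ⟨c, hc⟩
      (fun x hx => image_eq_zero_of_notMem_tsupport hx)
    set w : EuclideanSpace ℝ (Fin n) → ℝ := fun x => fderiv ℝ φ x v with hw
    have hwc : Continuous w := (hφ1.continuous_fderiv one_ne_zero).clm_apply continuous_const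
    have hwi : Integrable w := hwc.integrable_of_hasCompactSupport (hφc.fderiv_apply ℝ v)
    have hftc : ∀ x, φ (x - v) - φ x = -∫ s, w (x - s • v) ∂ν := by
      intro x
      have hd : ∀ s : ℝ, HasDerivAt (fun s : ℝ => φ (x - s • v)) (-w (x - s • v)) s := by
        intro s
        have h1 : HasDerivAt (fun s : ℝ => x - s • v) (-v) s := by
          simpa using ((hasDerivAt_id s).smul_const v).const_sub x
        exact (((hφ1.differentiable one_ne_zero) (x - s • v)).hasFDerivAt.comp_hasDerivAt s
          h1).congr_deriv (by simp [hw])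
      have := intervalIntegral.integral_eq_sub_of_hasDerivAt (a := 0) (b := 1) (fun s _ => hd s)
        (by apply Continuous.intervalIntegrable; fun_prop)
      rw [intervalIntegral.integral_of_le zero_le_one, integral_neg] at this
      simpa using this.symm
    -- Convexity makes the translated test function admissible: a point of `U` shifted by `s v`
    -- stays on a segment inside `Ω`.
    have hsupp : ∀ s ∈ Set.Ioc (0 : ℝ) 1, tsupport (fun x => φ (x - s • v)) ⊆ Ω := by
      intro s hs x hx
      have h1 : x - s • v ∈ tsupport φ := by
        have := tsupport_comp_subset_preimage φ (f := fun x => x - s • v) (by fun_prop) hx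
        exact this
      simpa using hseg _ (hφU h1) s (Set.Ioc_subset_Icc_self hs)
    have hby : ∀ s ∈ Set.Ioc (0 : ℝ) 1, ∫ x, u x * w (x - s • v)
        = -∫ x, inner ℝ (D (x + s • v)) v * φ x := by
      intro s hs
      have h1 := integral_mul_fderiv_eq_neg_inner (Ω := Ω) hu hM hloc hder
        (φ := fun x => φ (x - s • v)) (hφ1.comp (contDiff_id.sub contDiff_const))
        (by
          simp only [sub_eq_add_neg]
          exact hφc.comp_homeomorph (Homeomorph.addRight (-(s • v)))) (hsupp s hs) v
      simp only [fderiv_comp_sub] at h1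
      rw [h1, ← integral_add_right_eq_self
        (fun x => inner ℝ (D x) v * φ (x - s • v)) (s • v)]
      simp
    have hI2 : Integrable (fun p : EuclideanSpace ℝ (Fin n) × ℝ => u p.1 * w (p.1 - p.2 • v))
        (volume.prod ν) := by
      have := integrable_comp_add_smul hwc.stronglyMeasurable hwi (-v) ν
      simp only [smul_neg, ← sub_eq_add_neg] at this
      exact this.bdd_mul (c := M) (hu.comp measurable_fst).aestronglyMeasurable
        (Filter.Eventually.of_forall fun p => hM _)
    have hL : ∫ x, φ x * (u (x + v) - u x) = ∫ x, φ x * ∫ s, inner ℝ (D (x + s • v)) v ∂ν := by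
      calc ∫ x, φ x * (u (x + v) - u x)
          = (∫ x, u (x + v) * φ x) - ∫ x, u x * φ x := by
            have h0 := hutrans φ hφi 0
            simp only [add_zero] at h0
            rw [← integral_sub (hutrans φ hφi v) h0]
            congr 1; ext x; ring
        _ = (∫ x, u x * φ (x - v)) - ∫ x, u x * φ x := by
            rw [← integral_add_right_eq_self (fun x => u x * φ (x - v)) v]
            simp
        _ = ∫ x, -∫ s, u x * w (x - s • v) ∂ν := by
            have h0 := hutrans φ hφi 0
            have h1 := hutrans _ (hφi.comp_sub_right v) 0
            simp only [add_zero] at h0 h1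
            rw [← integral_sub h1 h0]
            congr 1; ext x
            rw [integral_const_mul, ← mul_sub, hftc]; ring
        _ = -∫ s, (∫ x, u x * w (x - s • v)) ∂ν := by
            rw [integral_neg, integral_integral_swap hI2]
        _ = ∫ s, (∫ x, inner ℝ (D (x + s • v)) v * φ x) ∂ν := by
            rw [← integral_neg]
            refine setIntegral_congr_fun measurableSet_Ioc fun s hs => ?_
            simp only [hby s hs, neg_neg]
        _ = ∫ x, φ x * ∫ s, inner ℝ (D (x + s • v)) v ∂ν := by
            rw [← integral_integral_swap hP]
            congr 1; ext x
            rw [integral_mul_const, mul_comm]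
    simp only [smul_eq_mul, mul_sub _ (u _ - u _)]
    rw [integral_sub, hL, sub_self]
    · have h0 := hutrans φ hφi 0
      simp only [add_zero] at h0
      refine ((hutrans φ hφi v).sub h0).congr (Filter.Eventually.of_forall fun x => ?_)
      simp; ring
    · refine hP.integral_prod_left.congr (Filter.Eventually.of_forall fun x => ?_)
      simp only []
      rw [integral_mul_const, mul_comm]

/-! ### Weighted Cauchy–Schwarz along a segment -/

/-- The weight `√(s (1 - s))` on the unit interval. -/
noncomputable def pathWeight (s : ℝ) : ℝ := √(s * (1 - s))

/-- The integral of the reciprocal of `pathWeight`. -/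
noncomputable def pathConst : ENNReal :=
  ∫⁻ s in Set.Ioo (0 : ℝ) 1, ENNReal.ofReal (pathWeight s)⁻¹

theorem measurable_pathWeight : Measurable pathWeight := by unfold pathWeight; fun_prop

theorem pathWeight_pos {s : ℝ} (hs : s ∈ Set.Ioo (0 : ℝ) 1) : 0 < pathWeight s :=
  Real.sqrt_pos.2 (mul_pos hs.1 (sub_pos.2 hs.2))

/-- Since `√s + √(1-s) ≥ s + (1-s) = 1`, the integrand is at most `s^(-1/2) + (1-s)^(-1/2)`. -/
theorem pathConst_ne_top : pathConst ≠ ⊤ := by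
  have h1 : IntegrableOn (fun s : ℝ => s ^ (-(1 / 2) : ℝ)) (Set.Ioo 0 1) := by
    rw [← integrableOn_Ioc_iff_integrableOn_Ioo, ← intervalIntegrable_iff_integrableOn_Ioc_of_le
      zero_le_one]
    exact intervalIntegral.intervalIntegrable_rpow' (by norm_num)
  have h2 : IntegrableOn (fun s : ℝ => (1 - s) ^ (-(1 / 2) : ℝ)) (Set.Ioo 0 1) := by
    rw [← integrableOn_Ioc_iff_integrableOn_Ioo, ← intervalIntegrable_iff_integrableOn_Ioc_of_le
      zero_le_one]
    have := (intervalIntegral.intervalIntegrable_rpow' (a := 0) (b := 1)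
      (r := (-(1 / 2) : ℝ)) (by norm_num)).comp_sub_left 1
    simpa using this.symm
  have h3 := (h1.add h2).lintegral_lt_top
  refine ((setLIntegral_mono_ae' measurableSet_Ioo
    (Eventually.of_forall fun s hs => ENNReal.ofReal_le_ofReal ?_)).trans_lt h3).ne
  have hs0 : 0 < s := hs.1
  have hs1 : 0 < 1 - s := sub_pos.2 hs.2
  have e : ∀ t : ℝ, 0 < t → t ^ (-(1 / 2) : ℝ) = (√t)⁻¹ := fun t ht => by
    rw [Real.rpow_neg ht.le, Real.sqrt_eq_rpow]
  simp only [Pi.add_apply, e s hs0, e _ hs1, pathWeight, Real.sqrt_mul hs0.le]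
  have ha := Real.sqrt_pos.2 hs0
  have hb := Real.sqrt_pos.2 hs1
  have hsum : 1 ≤ √s + √(1 - s) := by
    have h1 : s ≤ √s := Real.le_sqrt_of_sq_le (by nlinarith)
    have h2 : 1 - s ≤ √(1 - s) := Real.le_sqrt_of_sq_le (by nlinarith)
    linarith
  rw [← sub_nonneg]
  have : (√s)⁻¹ + (√(1 - s))⁻¹ - (√s * √(1 - s))⁻¹ = (√s + √(1 - s) - 1) / (√s * √(1 - s)) := by
    field_simp
    ring
  rw [this]
  exact div_nonneg (sub_nonneg.2 hsum) (by positivity)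

/-- Cauchy–Schwarz for `|g| = (√κ |g|) · √(1/κ)`, where `κ` is `pathWeight`. A non-integrable `g`
does no harm, as its Bochner integral is `0`. -/
theorem ofReal_sq_integral_le (g : ℝ → ℝ) (hg : Measurable g) :
    ENNReal.ofReal ((∫ s in Set.Ioo (0 : ℝ) 1, g s) ^ 2)
      ≤ pathConst * ∫⁻ s in Set.Ioo (0 : ℝ) 1, ENNReal.ofReal (pathWeight s * g s ^ 2) := by
  set ν := (volume : Measure ℝ).restrict (Set.Ioo (0 : ℝ) 1)
  have hm := measurable_pathWeight
  have h1 : ‖∫ s, g s ∂ν‖ₑ ≤ ∫⁻ s, ENNReal.ofReal (√(pathWeight s) * |g s|)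
      * ENNReal.ofReal √(pathWeight s)⁻¹ ∂ν := by
    refine (enorm_integral_le_lintegral_enorm _).trans (le_of_eq ?_)
    refine setLIntegral_congr_fun measurableSet_Ioo fun s hs => ?_
    have := Real.sqrt_pos.2 (pathWeight_pos hs)
    rw [← ENNReal.ofReal_mul (by positivity), Real.sqrt_inv, Real.enorm_eq_ofReal_abs]
    congr 1
    field_simp
  have h2 := h1.trans (ENNReal.lintegral_mul_le_Lp_mul_Lq ν Real.HolderConjugate.two_two
    (by fun_prop) (by fun_prop))
  have e1 : ∀ s, ENNReal.ofReal (√(pathWeight s) * |g s|) ^ (2 : ℝ)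
      = ENNReal.ofReal (pathWeight s * g s ^ 2) := by
    intro s
    rw [ENNReal.rpow_two, ← ENNReal.ofReal_pow (by positivity), mul_pow,
      Real.sq_sqrt (show 0 ≤ pathWeight s from Real.sqrt_nonneg _), sq_abs]
  have e2 : ∀ s, ENNReal.ofReal √(pathWeight s)⁻¹ ^ (2 : ℝ) = ENNReal.ofReal (pathWeight s)⁻¹ := by
    intro s
    rw [ENNReal.rpow_two, ← ENNReal.ofReal_pow (by positivity),
      Real.sq_sqrt (inv_nonneg.2 (show 0 ≤ pathWeight s from Real.sqrt_nonneg _))]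
  simp only [e1, e2] at h2
  have h3 := pow_le_pow_left₀ (zero_le) h2 2
  have h4 : ∀ a : ENNReal, (a ^ (1 / 2 : ℝ)) ^ 2 = a := fun a => by
    rw [← ENNReal.rpow_natCast, ← ENNReal.rpow_mul]; norm_num
  rw [mul_pow, h4, h4, Real.enorm_eq_ofReal_abs, ← ENNReal.ofReal_pow (abs_nonneg _), sq_abs,
    mul_comm] at h3
  exact h3

/-- The smooth truncation `M f / (M + f)` keeps line derivatives at every point, unlike `min f M`,
and multiplies them by a factor at most `1`. -/
theorem HasLineDerivAt.truncate {E : Type*} [AddCommGroup E] [Module ℝ E] {f : E → ℝ} {a M : ℝ}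
    {x v : E} (hM : 0 < M) (hf : 0 ≤ f x) (h : HasLineDerivAt ℝ f a x v) :
    HasLineDerivAt ℝ (fun x => f x * (M / (M + f x))) ((M / (M + f x)) ^ 2 * a) x v := by
  unfold HasLineDerivAt at *
  have h0 : M + f x ≠ 0 := by positivity
  have h1 := h.mul ((hasDerivAt_const (0 : ℝ) M).div (h.const_add M) (by simpa using h0))
  refine h1.congr_deriv ?_
  simp
  field_simp
  ring

/-- The path identity holds for each bounded truncation of `f`. Truncating only shrinks the
gradient, so the right-hand side is uniform in the level and the level can tend to infinity on the
left. -/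
theorem ae_ofReal_sub_sq_le_path {n : ℕ} {Ω : Set (EuclideanSpace ℝ (Fin n))} (hΩ : IsOpen Ω)
    (hconv : Convex ℝ Ω)
    {f : EuclideanSpace ℝ (Fin n) → ℝ} (hf : Measurable f) (hf0 : ∀ x, 0 ≤ f x)
    {D : EuclideanSpace ℝ (Fin n) → EuclideanSpace ℝ (Fin n)} (hD : Measurable D)
    (hloc : ∀ K ⊆ Ω, IsCompact K → IntegrableOn D K)
    (hder : ∀ x ∈ Ω, ∀ i, HasLineDerivAt ℝ f (D x i) x (EuclideanSpace.single i 1))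
    (v : EuclideanSpace ℝ (Fin n)) :
    ∀ᵐ x, x ∈ Ω → x + v ∈ Ω → ENNReal.ofReal ((f (x + v) - f x) ^ 2)
      ≤ pathConst * ∫⁻ s in Set.Ioo (0 : ℝ) 1,
          ENNReal.ofReal (pathWeight s * inner ℝ (D (x + s • v)) v ^ 2) := by
  have hM : ∀ j : ℕ, (0 : ℝ) < j + 1 := fun j => by positivity
  -- `f * c j` is the truncation at level `M = j + 1`, which is bounded by `M`; its gradient is `(c
  -- j)² • D`.
  set c : ℕ → EuclideanSpace ℝ (Fin n) → ℝ := fun j x => ((j + 1 : ℝ) / (j + 1 + f x)) with hc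
  have hc0 : ∀ j x, 0 ≤ c j x := fun j x => by have := hf0 x; positivity
  have hc1 : ∀ j x, c j x ≤ 1 := fun j x => by
    have := hf0 x
    exact (div_le_one (by positivity)).2 (by linarith)
  have hcm : ∀ j, Measurable (c j) := fun j => by fun_prop
  have hbd : ∀ j x, |f x * c j x| ≤ j + 1 := by
    intro j x
    have h0 := hf0 x
    rw [abs_of_nonneg (mul_nonneg h0 (hc0 j x)), hc, ← mul_div_assoc,
      div_le_iff₀ (by positivity)]
    nlinarith [hM j]
  have hsq1 : ∀ j x, (c j x) ^ 2 ≤ 1 := fun j x => pow_le_one₀ (hc0 j x) (hc1 j x)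
  have hall := ae_all_iff.2 fun j : ℕ => ae_sub_eq_integral_inner hΩ hconv
    (u := fun x => f x * c j x) (hf.mul (hcm j)) (hbd j)
    (D := fun x => (c j x) ^ 2 • D x) (((hcm j).pow_const 2).smul hD)
    (fun K hK hKc => Integrable.mono (hloc K hK hKc) (((hcm j).pow_const 2).smul hD).aestronglyMeasurable
      (Eventually.of_forall fun x => by
        rw [norm_smul, Real.norm_of_nonneg (sq_nonneg _)]
        exact mul_le_of_le_one_left (norm_nonneg _) (hsq1 j x)))
    (fun x hx i => (hder x hx i).truncate (hM j) (hf0 x)) v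
  filter_upwards [hall] with x hx h1 h2
  have hlim : ∀ y, Tendsto (fun j => f y * c j y) atTop (𝓝 (f y)) := by
    intro y
    have := ((tendsto_natCast_div_add_atTop (f y)).comp (tendsto_add_atTop_nat 1)).const_mul (f y)
    simpa [Function.comp_def, hc] using this
  have hl : Tendsto (fun j => ENNReal.ofReal ((f (x + v) * c j (x + v) - f x * c j x) ^ 2)) atTop
      (𝓝 (ENNReal.ofReal ((f (x + v) - f x) ^ 2))) :=
    (ENNReal.continuous_ofReal.tendsto _).comp (((hlim (x + v)).sub (hlim x)).pow 2)
  refine le_of_tendsto hl (Eventually.of_forall fun j => ?_)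
  rw [hx j h1 h2, integral_Ioc_eq_integral_Ioo]
  have hmeas : Measurable fun s : ℝ => inner ℝ ((c j (x + s • v)) ^ 2 • D (x + s • v)) v := by
    have : Measurable fun y => inner ℝ (c j y ^ 2 • D y) v :=
      (((hcm j).pow_const 2).smul hD).inner measurable_const
    exact this.comp (by fun_prop)
  refine (ofReal_sq_integral_le _ hmeas).trans ?_
  refine mul_le_mul_right (lintegral_mono fun s => ENNReal.ofReal_le_ofReal
    (mul_le_mul_of_nonneg_left ?_ (Real.sqrt_nonneg _))) _
  rw [real_inner_smul_left, mul_pow]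
  exact mul_le_of_le_one_left (sq_nonneg _) (pow_le_one₀ (sq_nonneg _) (hsq1 _ _))

/-! ### Bridge bounds and the doubled Poincaré inequality -/

section Bridge

variable {B : Type*} [NormedAddCommGroup B] [InnerProductSpace ℝ B] [FiniteDimensional ℝ B]
  [MeasurableSpace B] [BorelSpace B]

/-- A bound for the conditional second moment of `z' - z`, given a point `q` of the segment from
`z` to `z'`, when `z` and `z'` are drawn from `r`. -/
def BridgeBound (r : B → ENNReal) (C : ENNReal) : Prop :=
  ∀ s ∈ Set.Ioo (0 : ℝ) 1, ∀ q : B,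
    ENNReal.ofReal (s * (1 - s)) *
        ∫⁻ w, ENNReal.ofReal (‖w‖ ^ 2) * (r (q - s • w) * r (q + (1 - s) • w))
      ≤ C * r q * ∫⁻ z, r z

/-- Insert the weighted path bound, interchange the integrals, and for fixed `s` change variables
from the endpoint `z` to the intermediate point `q = z + s w`. The bridge bound then integrates out
`w`. One factor `pathConst` comes from Cauchy–Schwarz, the other from integrating over `s`. -/
theorem BridgeBound.lintegral_sq_sub_le {r : B → ENNReal} {C : ENNReal} (hB : BridgeBound r C)
    (hr : Measurable r) {h : B → ℝ} (hh : Measurable h) {p : B → B} (hp : Measurable p)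
    (hpath : ∀ᵐ w, ∀ᵐ z, r z ≠ 0 → r (z + w) ≠ 0 → ENNReal.ofReal ((h (z + w) - h z) ^ 2)
      ≤ pathConst * ∫⁻ s in Set.Ioo (0 : ℝ) 1,
          ENNReal.ofReal (pathWeight s * inner ℝ (p (z + s • w)) w ^ 2)) :
    ∫⁻ z, r z * ∫⁻ z', r z' * ENNReal.ofReal ((h z' - h z) ^ 2)
      ≤ pathConst ^ 2 * C * ((∫⁻ z, r z) * ∫⁻ z, r z * ENNReal.ofReal (‖p z‖ ^ 2)) := by
  have hκ := measurable_pathWeight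
  set ν := (volume : Measure ℝ).restrict (Set.Ioo (0 : ℝ) 1) with hν
  set R := ∫⁻ z, r z
  have hstep : ∀ s ∈ Set.Ioo (0 : ℝ) 1,
      ∫⁻ w, ∫⁻ z, ENNReal.ofReal (pathWeight s) * (ENNReal.ofReal (‖w‖ ^ 2) * (r z * r (z + w))
          * ENNReal.ofReal (‖p (z + s • w)‖ ^ 2))
        ≤ ENNReal.ofReal (pathWeight s)⁻¹ *
          (C * (R * ∫⁻ z, r z * ENNReal.ofReal (‖p z‖ ^ 2))) := by
    intro s hs
    have hpos := pathWeight_pos hs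
    have e1 : ∀ w : B, ∫⁻ z, ENNReal.ofReal (pathWeight s) *
        (ENNReal.ofReal (‖w‖ ^ 2) * (r z * r (z + w)) * ENNReal.ofReal (‖p (z + s • w)‖ ^ 2))
        = ∫⁻ q, ENNReal.ofReal (pathWeight s) * (ENNReal.ofReal (‖w‖ ^ 2) *
          (r (q - s • w) * r (q + (1 - s) • w)) * ENNReal.ofReal (‖p q‖ ^ 2)) := by
      intro w
      rw [← lintegral_sub_right_eq_self _ (s • w)]
      congr 1; ext q
      rw [sub_add_cancel, show q - s • w + w = q + (1 - s) • w by module]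
    simp only [e1]
    rw [lintegral_lintegral_swap (by fun_prop), ← lintegral_const_mul _ (by fun_prop),
      ← lintegral_const_mul _ (by fun_prop), ← lintegral_const_mul _ (by fun_prop)]
    refine lintegral_mono fun q => ?_
    have e2 : ∀ w : B, ENNReal.ofReal (pathWeight s) * (ENNReal.ofReal (‖w‖ ^ 2) *
          (r (q - s • w) * r (q + (1 - s) • w)) * ENNReal.ofReal (‖p q‖ ^ 2))
        = (ENNReal.ofReal (pathWeight s) * ENNReal.ofReal (‖p q‖ ^ 2)) *
          (ENNReal.ofReal (‖w‖ ^ 2) * (r (q - s • w) * r (q + (1 - s) • w))) := fun w => by ring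
    simp only [e2]
    rw [lintegral_const_mul _ (by fun_prop)]
    -- Since `κ² = s(1-s)`, the weight `κ` splits into the factor `s(1-s)` required by `BridgeBound`
    -- and `1/κ`, which is integrable in `s`.
    have e3 : ENNReal.ofReal (pathWeight s)
        = ENNReal.ofReal (pathWeight s)⁻¹ * ENNReal.ofReal (s * (1 - s)) := by
      rw [← ENNReal.ofReal_mul (inv_nonneg.2 hpos.le)]
      congr 1
      rw [eq_inv_mul_iff_mul_eq₀ hpos.ne']
      exact Real.mul_self_sqrt (mul_nonneg hs.1.le (sub_nonneg.2 hs.2.le))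
    calc _ = ENNReal.ofReal (pathWeight s)⁻¹ * ENNReal.ofReal (‖p q‖ ^ 2) *
          (ENNReal.ofReal (s * (1 - s)) *
          ∫⁻ w, ENNReal.ofReal (‖w‖ ^ 2) * (r (q - s • w) * r (q + (1 - s) • w))) := by
            conv_lhs => rw [e3]
            ring
      _ ≤ ENNReal.ofReal (pathWeight s)⁻¹ * ENNReal.ofReal (‖p q‖ ^ 2) * (C * r q * R) := by
            exact mul_le_mul_right (hB s hs q) _
      _ = _ := by ring
  calc ∫⁻ z, r z * ∫⁻ z', r z' * ENNReal.ofReal ((h z' - h z) ^ 2)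
      = ∫⁻ z, ∫⁻ w, r z * (r (z + w) * ENNReal.ofReal ((h (z + w) - h z) ^ 2)) := by
        congr 1; ext z
        rw [← lintegral_const_mul _ (by fun_prop),
          ← lintegral_add_left_eq_self (fun z' => r z * (r z' * ENNReal.ofReal ((h z' - h z) ^ 2))) z]
    _ = ∫⁻ w, ∫⁻ z, r z * (r (z + w) * ENNReal.ofReal ((h (z + w) - h z) ^ 2)) :=
        lintegral_lintegral_swap (by fun_prop)
    _ ≤ ∫⁻ w, ∫⁻ z, pathConst * ∫⁻ s, ENNReal.ofReal (pathWeight s) *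
          (ENNReal.ofReal (‖w‖ ^ 2) * (r z * r (z + w))
          * ENNReal.ofReal (‖p (z + s • w)‖ ^ 2)) ∂ν := by
        refine lintegral_mono_ae (hpath.mono fun w hw => lintegral_mono_ae (hw.mono fun z hz => ?_))
        by_cases h1 : r z = 0
        · simp [h1]
        by_cases h2 : r (z + w) = 0
        · simp [h2]
        calc r z * (r (z + w) * ENNReal.ofReal ((h (z + w) - h z) ^ 2))
            ≤ r z * (r (z + w) * (pathConst * ∫⁻ s,
              ENNReal.ofReal (pathWeight s * inner ℝ (p (z + s • w)) w ^ 2) ∂ν)) := by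
              gcongr; exact hz h1 h2
          _ = pathConst * ∫⁻ s, (r z * r (z + w)) *
              ENNReal.ofReal (pathWeight s * inner ℝ (p (z + s • w)) w ^ 2) ∂ν := by
              rw [lintegral_const_mul _ (by fun_prop)]; ring
          _ ≤ _ := by
              refine mul_le_mul_right (lintegral_mono fun s => ?_) _
              calc (r z * r (z + w)) * ENNReal.ofReal (pathWeight s * inner ℝ (p (z + s • w)) w ^ 2)
                  ≤ (r z * r (z + w)) *
                    ENNReal.ofReal (pathWeight s * (‖w‖ ^ 2 * ‖p (z + s • w)‖ ^ 2)) := by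
                    refine mul_le_mul_right (ENNReal.ofReal_le_ofReal
                      (mul_le_mul_of_nonneg_left ?_ (Real.sqrt_nonneg _))) _
                    rw [← mul_pow, mul_comm ‖w‖]
                    exact sq_le_sq.2 (by
                      rw [abs_of_nonneg (by positivity : 0 ≤ ‖p (z + s • w)‖ * ‖w‖)]
                      exact abs_real_inner_le_norm _ _)
                _ = _ := by
                    rw [ENNReal.ofReal_mul (show 0 ≤ pathWeight s from Real.sqrt_nonneg _),
                      ENNReal.ofReal_mul (sq_nonneg _)]
                    ring
    _ = pathConst * ∫⁻ s, ∫⁻ w, ∫⁻ z, ENNReal.ofReal (pathWeight s) *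
          (ENNReal.ofReal (‖w‖ ^ 2) * (r z * r (z + w))
          * ENNReal.ofReal (‖p (z + s • w)‖ ^ 2)) ∂volume ∂volume ∂ν := by
        have e1 : ∀ w : B, ∫⁻ z, pathConst * ∫⁻ s, ENNReal.ofReal (pathWeight s) *
          (ENNReal.ofReal (‖w‖ ^ 2) * (r z * r (z + w))
          * ENNReal.ofReal (‖p (z + s • w)‖ ^ 2)) ∂ν ∂volume = pathConst * ∫⁻ s, ∫⁻ z,
          ENNReal.ofReal (pathWeight s) *
          (ENNReal.ofReal (‖w‖ ^ 2) * (r z * r (z + w))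
          * ENNReal.ofReal (‖p (z + s • w)‖ ^ 2)) ∂volume ∂ν := by
          intro w
          rw [lintegral_const_mul _ (by fun_prop), lintegral_lintegral_swap (by fun_prop)]
        simp only [e1]
        rw [lintegral_const_mul _ (by fun_prop), lintegral_lintegral_swap (by fun_prop)]
    _ ≤ pathConst * ∫⁻ s, ENNReal.ofReal (pathWeight s)⁻¹ *
          (C * (R * ∫⁻ z, r z * ENNReal.ofReal (‖p z‖ ^ 2))) ∂ν := by
        gcongr 1
        exact setLIntegral_mono_ae' measurableSet_Ioo (Eventually.of_forall hstep)
    _ = _ := by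
        rw [lintegral_mul_const _ (by fun_prop)]
        change pathConst * (pathConst * _) = _
        ring

/-- The integrand is supported where both endpoints lie in `S`. There `‖w‖ ≤ R`, and `q` lies in `S`
by convexity. Discard one endpoint and rescale in `w` along the other. -/
theorem bridgeBound_indicator {S : Set B} (hS : MeasurableSet S) (hconv : Convex ℝ S) {R : ℝ}
    (hR : ∀ x ∈ S, ∀ y ∈ S, ‖y - x‖ ≤ R) (c : ENNReal) :
    BridgeBound (S.indicator fun _ => c)
      (ENNReal.ofReal (R ^ 2 * 2 ^ Module.finrank ℝ B)) := by
  intro s hs q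
  set r : B → ENNReal := S.indicator fun _ => c with hrdef
  have hr : Measurable r := measurable_const.indicator hS
  have hs0 : 0 < s := hs.1
  have hs1 : 0 < 1 - s := sub_pos.2 hs.2
  set d := Module.finrank ℝ B
  have hpt : ∀ w, ENNReal.ofReal (‖w‖ ^ 2) * (r (q - s • w) * r (q + (1 - s) • w))
      ≤ ENNReal.ofReal (R ^ 2) * r q * r (q - s • w) ∧
      ENNReal.ofReal (‖w‖ ^ 2) * (r (q - s • w) * r (q + (1 - s) • w))
      ≤ ENNReal.ofReal (R ^ 2) * r q * r (q + (1 - s) • w) := by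
    intro w
    by_cases h1 : q - s • w ∈ S
    swap
    · simp [hrdef, h1]
    by_cases h2 : q + (1 - s) • w ∈ S
    swap
    · simp [hrdef, h2]
    have hw : ‖w‖ ≤ R := by
      have := hR _ h1 _ h2
      rwa [show q + (1 - s) • w - (q - s • w) = w by module] at this
    have hq : q ∈ S := by
      have := hconv h1 h2 hs1.le hs0.le (by ring)
      convert this using 1
      module
    simp only [hrdef, Set.indicator_of_mem h1, Set.indicator_of_mem h2, Set.indicator_of_mem hq]
    rw [mul_assoc, and_self]
    gcongr
  -- The Jacobian is `|a|^(-d) ≤ 2^d`. One of `s`, `1 - s` is at least `1/2`, and that endpoint is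
  -- the one kept below.
  have hscale : ∀ a : ℝ, 1 / 2 ≤ |a| → ∫⁻ w, r (q + a • w) ≤ ENNReal.ofReal (2 ^ d) * ∫⁻ z, r z := by
    intro a ha
    have ha0 : a ≠ 0 := by rintro rfl; norm_num at ha
    have h1 : ∫⁻ w, r (q + a • w) = ∫⁻ w, r (q + w) ∂(Measure.map (a • ·) volume) := by
      rw [lintegral_map (by fun_prop) (by fun_prop)]
    rw [h1, Measure.map_addHaar_smul _ ha0, lintegral_smul_measure,
      lintegral_add_left_eq_self r q, smul_eq_mul]
    gcongr
    rw [abs_inv, abs_pow, ← inv_pow]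
    gcongr
    rw [inv_le_comm₀ (by positivity) two_pos]
    linarith
  have hscale' : ∫⁻ w, ENNReal.ofReal (‖w‖ ^ 2) * (r (q - s • w) * r (q + (1 - s) • w))
      ≤ ENNReal.ofReal (R ^ 2) * r q * (ENNReal.ofReal (2 ^ d) * ∫⁻ z, r z) := by
    rcases le_total s (1 / 2) with h | h
    · refine (lintegral_mono fun w => (hpt w).2).trans ?_
      rw [lintegral_const_mul _ (by fun_prop)]
      gcongr
      exact hscale _ (by rw [abs_of_pos hs1]; linarith)
    · refine (lintegral_mono fun w => (hpt w).1).trans ?_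
      rw [lintegral_const_mul _ (by fun_prop)]
      gcongr
      have := hscale (-s) (by rw [abs_neg, abs_of_pos hs0]; linarith)
      simpa [sub_eq_add_neg] using this
  calc _ ≤ 1 * (ENNReal.ofReal (R ^ 2) * r q * (ENNReal.ofReal (2 ^ d) * ∫⁻ z, r z)) := by
        gcongr
        rw [ENNReal.ofReal_le_one]
        nlinarith
    _ = _ := by
        rw [ENNReal.ofReal_mul (sq_nonneg R)]; ring

/-- Completing the square in `w` bounds the product of the two Gaussians by the Gaussian at `q`,
times a Gaussian in `w` whose width is bounded uniformly in `s`, with `exp(-a‖w‖²/2)` left over to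
absorb the second-moment factor `a‖w‖²`, where `a = s(1-s)`. -/
theorem bridgeBound_gaussian (c : ℝ) (hc : 0 ≤ c) :
    BridgeBound (fun z : B => ENNReal.ofReal (c * Real.exp (-‖z‖ ^ 2 / 2)))
      (ENNReal.ofReal (2 * 2 ^ Module.finrank ℝ B)) := by
  intro s hs q
  have hs0 : 0 < s := hs.1
  have hs1 : 0 < 1 - s := sub_pos.2 hs.2
  set d := Module.finrank ℝ B
  set a := s * (1 - s) with ha
  have ha0 : 0 < a := mul_pos hs0 hs1
  have ha4 : a ≤ 1 / 4 := by nlinarith [sq_nonneg (s - 1 / 2)]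
  -- The exponents give `2‖q‖² + 2(1-2s)⟪q,w⟫ + (1-2a)‖w‖²`. Removing `‖q‖² + a‖w‖²` leaves a
  -- quadratic form in `w` with leading coefficient `1 - 3a` and centre `-b q`.
  set b := (1 - 2 * s) / (1 - 3 * a) with hb
  have hden : 1 / 4 ≤ 1 - 3 * a := by linarith
  have hmain : ∀ w : B, ENNReal.ofReal a * (ENNReal.ofReal (‖w‖ ^ 2) *
      (ENNReal.ofReal (c * Real.exp (-‖q - s • w‖ ^ 2 / 2)) *
        ENNReal.ofReal (c * Real.exp (-‖q + (1 - s) • w‖ ^ 2 / 2))))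
      ≤ ENNReal.ofReal 2 * ENNReal.ofReal (c * Real.exp (-‖q‖ ^ 2 / 2)) *
        ENNReal.ofReal (c * Real.exp (-‖(1 / 2 : ℝ) • (w + b • q)‖ ^ 2 / 2)) := by
    intro w
    rw [← ENNReal.ofReal_mul (by positivity), ← ENNReal.ofReal_mul (by positivity),
      ← ENNReal.ofReal_mul (by positivity), ← ENNReal.ofReal_mul (by positivity),
      ← ENNReal.ofReal_mul (by positivity)]
    refine ENNReal.ofReal_le_ofReal ?_
    have n1 : ‖q - s • w‖ ^ 2 = ‖q‖ ^ 2 - 2 * s * inner ℝ q w + s ^ 2 * ‖w‖ ^ 2 := by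
      rw [norm_sub_sq_real, real_inner_smul_right, norm_smul, mul_pow, Real.norm_eq_abs, sq_abs]
      ring
    have n2 : ‖q + (1 - s) • w‖ ^ 2
        = ‖q‖ ^ 2 + 2 * (1 - s) * inner ℝ q w + (1 - s) ^ 2 * ‖w‖ ^ 2 := by
      rw [norm_add_sq_real, real_inner_smul_right, norm_smul, mul_pow, Real.norm_eq_abs, sq_abs]
      ring
    have n3 : ‖(1 / 2 : ℝ) • (w + b • q)‖ ^ 2
        = 1 / 4 * (‖w‖ ^ 2 + 2 * b * inner ℝ q w + b ^ 2 * ‖q‖ ^ 2) := by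
      rw [norm_smul, mul_pow, norm_add_sq_real, real_inner_smul_right, norm_smul b, mul_pow,
        real_inner_comm]
      simp only [Real.norm_eq_abs, sq_abs]
      ring
    have n4 : 0 ≤ ‖w‖ ^ 2 + 2 * b * inner ℝ q w + b ^ 2 * ‖q‖ ^ 2 := by
      have : 0 ≤ ‖(1 / 2 : ℝ) • (w + b • q)‖ ^ 2 := sq_nonneg _
      rw [n3] at this
      linarith
    have hexp : a * ‖w‖ ^ 2 ≤ 2 * Real.exp (a * ‖w‖ ^ 2 / 2) := by
      have := Real.add_one_le_exp (a * ‖w‖ ^ 2 / 2)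
      linarith
    have hquad : ‖q‖ ^ 2 + ‖(1 / 2 : ℝ) • (w + b • q)‖ ^ 2 + a * ‖w‖ ^ 2
        ≤ ‖q - s • w‖ ^ 2 + ‖q + (1 - s) • w‖ ^ 2 := by
      have h1 : 1 / 4 * (‖w‖ ^ 2 + 2 * b * inner ℝ q w + b ^ 2 * ‖q‖ ^ 2)
          ≤ (1 - 3 * a) * (‖w‖ ^ 2 + 2 * b * inner ℝ q w + b ^ 2 * ‖q‖ ^ 2) :=
        mul_le_mul_of_nonneg_right hden n4
      have hb1 : (1 - 3 * a) * b = 1 - 2 * s := by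
        rw [hb]; field_simp
      -- This is `(1-2s)² = 1 - 4a ≤ 1 - 3a`.
      have hb2 : (1 - 3 * a) * b ^ 2 ≤ 1 := by
        have : (1 - 3 * a) * ((1 - 3 * a) * b ^ 2) ≤ (1 - 3 * a) * 1 := by
          calc (1 - 3 * a) * ((1 - 3 * a) * b ^ 2) = ((1 - 3 * a) * b) ^ 2 := by ring
            _ = (1 - 2 * s) ^ 2 := by rw [hb1]
            _ ≤ (1 - 3 * a) * 1 := by rw [ha]; nlinarith
        exact le_of_mul_le_mul_left this (by linarith)
      have h2 : (1 - 3 * a) * (‖w‖ ^ 2 + 2 * b * inner ℝ q w + b ^ 2 * ‖q‖ ^ 2)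
          ≤ (1 - 3 * a) * ‖w‖ ^ 2 + 2 * (1 - 2 * s) * inner ℝ q w + ‖q‖ ^ 2 := by
        have := mul_le_mul_of_nonneg_right hb2 (sq_nonneg ‖q‖)
        calc _ = (1 - 3 * a) * ‖w‖ ^ 2 + 2 * ((1 - 3 * a) * b) * inner ℝ q w
              + (1 - 3 * a) * b ^ 2 * ‖q‖ ^ 2 := by ring
          _ ≤ _ := by rw [hb1]; linarith
      rw [n1, n2, n3]
      refine (add_le_add_left (add_le_add_right (h1.trans h2) _) _).trans (le_of_eq ?_)
      rw [ha]; ring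
    calc a * (‖w‖ ^ 2 * (c * Real.exp (-‖q - s • w‖ ^ 2 / 2) *
          (c * Real.exp (-‖q + (1 - s) • w‖ ^ 2 / 2))))
        = c ^ 2 * ((a * ‖w‖ ^ 2) *
          Real.exp (-(‖q - s • w‖ ^ 2 + ‖q + (1 - s) • w‖ ^ 2) / 2)) := by
          rw [neg_add, add_div, Real.exp_add]; ring
      _ ≤ c ^ 2 * ((2 * Real.exp (a * ‖w‖ ^ 2 / 2)) * Real.exp
          (-(‖q‖ ^ 2 + ‖(1 / 2 : ℝ) • (w + b • q)‖ ^ 2 + a * ‖w‖ ^ 2) / 2)) := by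
          gcongr
      _ = _ := by
          have : Real.exp (-(‖q‖ ^ 2 + ‖(1 / 2 : ℝ) • (w + b • q)‖ ^ 2 + a * ‖w‖ ^ 2) / 2)
            = Real.exp (-‖q‖ ^ 2 / 2) * Real.exp (-‖(1 / 2 : ℝ) • (w + b • q)‖ ^ 2 / 2) *
              (Real.exp (a * ‖w‖ ^ 2 / 2))⁻¹ := by
            rw [← Real.exp_neg, ← Real.exp_add, ← Real.exp_add]
            congr 1; ring
          rw [this]
          field_simp
  rw [← lintegral_const_mul _ (by fun_prop)]
  refine (lintegral_mono hmain).trans (le_of_eq ?_)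
  rw [lintegral_const_mul _ (by fun_prop)]
  have h1 : ∫⁻ w : B, ENNReal.ofReal (c * Real.exp (-‖(1 / 2 : ℝ) • (w + b • q)‖ ^ 2 / 2))
      = ENNReal.ofReal (2 ^ d) * ∫⁻ w : B, ENNReal.ofReal (c * Real.exp (-‖w‖ ^ 2 / 2)) := by
    rw [lintegral_add_right_eq_self
      (fun w : B => ENNReal.ofReal (c * Real.exp (-‖(1 / 2 : ℝ) • w‖ ^ 2 / 2)))]
    have := lintegral_map (μ := (volume : Measure B))
      (f := fun w : B => ENNReal.ofReal (c * Real.exp (-‖w‖ ^ 2 / 2)))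
      (g := ((1 / 2 : ℝ) • ·)) (by fun_prop) (by fun_prop)
    rw [← this, Measure.map_addHaar_smul _ (by norm_num), lintegral_smul_measure, smul_eq_mul]
    congr 2
    rw [abs_of_pos (by positivity)]
    simp [d]
  rw [h1, ENNReal.ofReal_mul two_pos.le]
  ring

end Bridge

/-! ### Rotated coordinates and slices -/

section Slices

variable {k m : ℕ}

/-- The inactive variable `z = W₂ᵀ x`. -/
noncomputable def inactiveVar (W : Matrix (Fin (k + m)) (Fin (k + m)) ℝ)
    (x : EuclideanSpace ℝ (Fin (k + m))) : EuclideanSpace ℝ (Fin m) :=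
  WithLp.toLp 2 ((inactiveCols W)ᵀ *ᵥ x.ofLp)

variable {W : Matrix (Fin (k + m)) (Fin (k + m)) ℝ}

theorem point_eq_mulVec (W : Matrix (Fin (k + m)) (Fin (k + m)) ℝ) (y : EuclideanSpace ℝ (Fin k))
    (z : EuclideanSpace ℝ (Fin m)) :
    (point W y z).ofLp = W *ᵥ Fin.append y.ofLp z.ofLp := by
  ext i
  simp [point, activeCols, inactiveCols, Matrix.mulVec, dotProduct, Fin.sum_univ_add]

theorem append_activeVar_inactiveVar (W : Matrix (Fin (k + m)) (Fin (k + m)) ℝ)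
    (x : EuclideanSpace ℝ (Fin (k + m))) :
    Fin.append (activeVar W x).ofLp (inactiveVar W x).ofLp = Wᵀ *ᵥ x.ofLp := by
  ext i
  refine Fin.addCases (fun i => ?_) (fun i => ?_) i
  · simp [activeVar, activeCols, Matrix.mulVec, dotProduct]
  · simp [inactiveVar, inactiveCols, Matrix.mulVec, dotProduct]

theorem point_activeVar_inactiveVar (hW : W ∈ Matrix.orthogonalGroup (Fin (k + m)) ℝ)
    (x : EuclideanSpace ℝ (Fin (k + m))) : point W (activeVar W x) (inactiveVar W x) = x := by
  apply WithLp.ofLp_injective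
  rw [point_eq_mulVec, append_activeVar_inactiveVar, Matrix.mulVec_mulVec]
  rw [(Matrix.mem_orthogonalGroup_iff (Fin (k + m)) ℝ).1 hW, Matrix.one_mulVec]

theorem append_vars_point (hW : W ∈ Matrix.orthogonalGroup (Fin (k + m)) ℝ)
    (y : EuclideanSpace ℝ (Fin k)) (z : EuclideanSpace ℝ (Fin m)) :
    Fin.append (activeVar W (point W y z)).ofLp (inactiveVar W (point W y z)).ofLp
      = Fin.append y.ofLp z.ofLp := by
  rw [append_activeVar_inactiveVar, point_eq_mulVec, Matrix.mulVec_mulVec,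
    (Matrix.mem_orthogonalGroup_iff' (Fin (k + m)) ℝ).1 hW, Matrix.one_mulVec]

theorem activeVar_point (hW : W ∈ Matrix.orthogonalGroup (Fin (k + m)) ℝ)
    (y : EuclideanSpace ℝ (Fin k)) (z : EuclideanSpace ℝ (Fin m)) :
    activeVar W (point W y z) = y := by
  ext i
  have := congrFun (append_vars_point hW y z) (Fin.castAdd m i)
  simpa using this

theorem point_add_smul (W : Matrix (Fin (k + m)) (Fin (k + m)) ℝ) (y : EuclideanSpace ℝ (Fin k))
    (z w : EuclideanSpace ℝ (Fin m)) (s : ℝ) :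
    point W y (z + s • w) = point W y z + s • point W 0 w := by
  apply WithLp.ofLp_injective
  simp [point, Matrix.mulVec_add, Matrix.mulVec_smul, add_assoc]

theorem inner_point_zero (W : Matrix (Fin (k + m)) (Fin (k + m)) ℝ)
    (x : EuclideanSpace ℝ (Fin (k + m))) (w : EuclideanSpace ℝ (Fin m)) :
    inner ℝ x (point W 0 w) = inner ℝ (inactiveVar W x) w := by
  simp only [EuclideanSpace.inner_eq_star_dotProduct, star_trivial, point, inactiveVar,
    WithLp.ofLp_zero, Matrix.mulVec_zero, zero_add]
  rw [dotProduct_comm, Matrix.dotProduct_mulVec, Matrix.mulVec_transpose, dotProduct_comm]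

theorem norm_point_sq (hW : W ∈ Matrix.orthogonalGroup (Fin (k + m)) ℝ)
    (y : EuclideanSpace ℝ (Fin k)) (z : EuclideanSpace ℝ (Fin m)) :
    ‖point W y z‖ ^ 2 = ‖y‖ ^ 2 + ‖z‖ ^ 2 := by
  have h1 : ‖point W y z‖ ^ 2 = (point W y z).ofLp ⬝ᵥ (point W y z).ofLp := by
    rw [EuclideanSpace.real_norm_sq_eq, dotProduct]
    simp only [sq]
  rw [h1, point_eq_mulVec, Matrix.dotProduct_mulVec, ← Matrix.mulVec_transpose, Matrix.mulVec_mulVec,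
    (Matrix.mem_orthogonalGroup_iff' (Fin (k + m)) ℝ).1 hW, Matrix.one_mulVec,
    EuclideanSpace.real_norm_sq_eq, EuclideanSpace.real_norm_sq_eq, dotProduct, Fin.sum_univ_add]
  simp only [Fin.append_left, Fin.append_right, sq]

@[fun_prop]
theorem continuous_point (W : Matrix (Fin (k + m)) (Fin (k + m)) ℝ) :
    Continuous fun p : EuclideanSpace ℝ (Fin k) × EuclideanSpace ℝ (Fin m) => point W p.1 p.2 := by
  unfold point
  fun_prop

@[fun_prop]
theorem continuous_activeVar (W : Matrix (Fin (k + m)) (Fin (k + m)) ℝ) :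
    Continuous (activeVar W) := by
  unfold activeVar
  fun_prop

@[fun_prop]
theorem continuous_inactiveVar (W : Matrix (Fin (k + m)) (Fin (k + m)) ℝ) :
    Continuous (inactiveVar W) := by
  unfold inactiveVar
  fun_prop

theorem measurable_point_comp {α : Type*} [MeasurableSpace α] {a : α → EuclideanSpace ℝ (Fin k)}
    {b : α → EuclideanSpace ℝ (Fin m)} (ha : Measurable a) (hb : Measurable b) :
    Measurable fun t => point W (a t) (b t) :=
  (continuous_point W).measurable.comp (ha.prodMk hb)

/-- The columns of `W` are orthonormal, so the map is a linear isometry from the `L²` product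
between spaces of equal dimension. -/
theorem measurePreserving_point (hW : W ∈ Matrix.orthogonalGroup (Fin (k + m)) ℝ) :
    MeasurePreserving
      (fun p : EuclideanSpace ℝ (Fin k) × EuclideanSpace ℝ (Fin m) => point W p.1 p.2) := by
  let T : WithLp 2 (EuclideanSpace ℝ (Fin k) × EuclideanSpace ℝ (Fin m)) →ₗᵢ[ℝ]
      EuclideanSpace ℝ (Fin (k + m)) :=
    { toFun := fun p => point W p.fst p.snd
      map_add' := fun p q => by
        apply WithLp.ofLp_injective
        simp [point, Matrix.mulVec_add]
        abel
      map_smul' := fun c p => by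
        apply WithLp.ofLp_injective
        simp [point, Matrix.mulVec_smul]
      norm_map' := fun p => by
        refine (sq_eq_sq₀ (norm_nonneg _) (norm_nonneg _)).1 ?_
        rw [WithLp.prod_norm_sq_eq_of_L2]
        exact norm_point_sq hW _ _ }
  have hrank : Module.finrank ℝ (WithLp 2 (EuclideanSpace ℝ (Fin k) × EuclideanSpace ℝ (Fin m)))
      = Module.finrank ℝ (EuclideanSpace ℝ (Fin (k + m))) := by
    rw [LinearEquiv.finrank_eq (WithLp.linearEquiv 2 ℝ _)]
    simp
  exact (T.toLinearIsometryEquiv hrank).measurePreserving.comp (WithLp.volume_preserving_toLp _ _)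

theorem lintegral_point (hW : W ∈ Matrix.orthogonalGroup (Fin (k + m)) ℝ)
    {g : EuclideanSpace ℝ (Fin (k + m)) → ENNReal} (hg : Measurable g) :
    ∫⁻ x, g x = ∫⁻ y, ∫⁻ z, g (point W y z) := by
  rw [← (measurePreserving_point hW).lintegral_comp hg,
    Measure.volume_eq_prod, lintegral_prod _ (by
      exact (hg.comp (continuous_point W).measurable).aemeasurable)]

/-- Apply the path bound with `v = W₂ w` for each `w`, then exchange the almost-everywhere
quantifiers by Fubini, so that almost every slice satisfies it for almost all `w` and `z`. Along
such `v` only the inactive component of the gradient is seen. -/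
theorem ae_slice_path (hW : W ∈ Matrix.orthogonalGroup (Fin (k + m)) ℝ)
    {r : EuclideanSpace ℝ (Fin (k + m)) → ENNReal} (hr : Measurable r)
    {f : EuclideanSpace ℝ (Fin (k + m)) → ℝ} (hf : Measurable f)
    {D : EuclideanSpace ℝ (Fin (k + m)) → EuclideanSpace ℝ (Fin (k + m))} (hD : Measurable D)
    (hpath : ∀ v, ∀ᵐ x, r x ≠ 0 → r (x + v) ≠ 0 → ENNReal.ofReal ((f (x + v) - f x) ^ 2)
      ≤ pathConst * ∫⁻ s in Set.Ioo (0 : ℝ) 1,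
          ENNReal.ofReal (pathWeight s * inner ℝ (D (x + s • v)) v ^ 2)) :
    ∀ᵐ y, ∀ᵐ w, ∀ᵐ z, r (point W y z) ≠ 0 → r (point W y (z + w)) ≠ 0 →
      ENNReal.ofReal ((f (point W y (z + w)) - f (point W y z)) ^ 2)
      ≤ pathConst * ∫⁻ s in Set.Ioo (0 : ℝ) 1, ENNReal.ofReal (pathWeight s *
          inner ℝ (inactiveVar W (D (point W y (z + s • w)))) w ^ 2) := by
  have hκ := measurable_pathWeight
  set P : EuclideanSpace ℝ (Fin m) → EuclideanSpace ℝ (Fin k) → EuclideanSpace ℝ (Fin m) → Prop :=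
    fun w y z => r (point W y z) ≠ 0 → r (point W y (z + w)) ≠ 0 →
      ENNReal.ofReal ((f (point W y (z + w)) - f (point W y z)) ^ 2)
      ≤ pathConst * ∫⁻ s in Set.Ioo (0 : ℝ) 1, ENNReal.ofReal (pathWeight s *
          inner ℝ (inactiveVar W (D (point W y (z + s • w)))) w ^ 2) with hP
  have hmeas : MeasurableSet {q : EuclideanSpace ℝ (Fin m) ×
      (EuclideanSpace ℝ (Fin k) × EuclideanSpace ℝ (Fin m)) | P q.1 q.2.1 q.2.2} := by
    have m1 : Measurable fun q : EuclideanSpace ℝ (Fin m) ×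
      (EuclideanSpace ℝ (Fin k) × EuclideanSpace ℝ (Fin m)) => point W q.2.1 q.2.2 :=
      measurable_point_comp (by fun_prop) (by fun_prop)
    have m2 : Measurable fun q : EuclideanSpace ℝ (Fin m) ×
      (EuclideanSpace ℝ (Fin k) × EuclideanSpace ℝ (Fin m)) => point W q.2.1 (q.2.2 + q.1) :=
      measurable_point_comp (by fun_prop) (by fun_prop)
    have m3 : Measurable fun q : (EuclideanSpace ℝ (Fin m) ×
      (EuclideanSpace ℝ (Fin k) × EuclideanSpace ℝ (Fin m))) × ℝ =>
        ENNReal.ofReal (pathWeight q.2 * inner ℝ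
          (inactiveVar W (D (point W q.1.2.1 (q.1.2.2 + q.2 • q.1.1)))) q.1.1 ^ 2) := by
      have h1 : Measurable fun q : (EuclideanSpace ℝ (Fin m) ×
        (EuclideanSpace ℝ (Fin k) × EuclideanSpace ℝ (Fin m))) × ℝ =>
          point W q.1.2.1 (q.1.2.2 + q.2 • q.1.1) :=
        measurable_point_comp (by fun_prop) (by fun_prop)
      have h2 := (continuous_inactiveVar W).measurable.comp (hD.comp h1)
      have h3 := h2.inner (𝕜 := ℝ) (measurable_fst.comp measurable_fst)
      exact ((hκ.comp measurable_snd).mul (h3.pow_const 2)).ennreal_ofReal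
    have n1 : MeasurableSet {q : EuclideanSpace ℝ (Fin m) ×
      (EuclideanSpace ℝ (Fin k) × EuclideanSpace ℝ (Fin m)) | r (point W q.2.1 q.2.2) ≠ 0} :=
      ((hr.comp m1) (measurableSet_singleton 0)).compl
    have n2 : MeasurableSet {q : EuclideanSpace ℝ (Fin m) ×
      (EuclideanSpace ℝ (Fin k) × EuclideanSpace ℝ (Fin m)) |
        r (point W q.2.1 (q.2.2 + q.1)) ≠ 0} :=
      ((hr.comp m2) (measurableSet_singleton 0)).compl
    have n3 := measurableSet_le ((((hf.comp m2).sub (hf.comp m1)).pow_const 2).ennreal_ofReal)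
      ((m3.lintegral_prod_right' (ν := volume.restrict (Set.Ioo (0 : ℝ) 1))).const_mul pathConst)
    exact n1.imp (n2.imp n3)
  have h1 : ∀ w, ∀ᵐ p : EuclideanSpace ℝ (Fin k) × EuclideanSpace ℝ (Fin m), P w p.1 p.2 := by
    intro w
    filter_upwards [(measurePreserving_point hW).quasiMeasurePreserving.ae (hpath (point W 0 w))]
      with p hp h1 h2
    have e1 : point W p.1 (p.2 + w) = point W p.1 p.2 + point W 0 w := by
      simpa using point_add_smul W p.1 p.2 w 1
    rw [e1] at h2 ⊢
    have := hp h1 h2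
    simpa only [point_add_smul, inner_point_zero] using this
  have h2 : ∀ᵐ p : EuclideanSpace ℝ (Fin k) × EuclideanSpace ℝ (Fin m), ∀ᵐ w, P w p.1 p.2 :=
    (Measure.ae_ae_comm (μ := volume) (ν := volume)
      (p := fun w (p : EuclideanSpace ℝ (Fin k) × EuclideanSpace ℝ (Fin m)) => P w p.1 p.2)
      hmeas).1 (Eventually.of_forall h1)
  rw [Measure.volume_eq_prod] at h2
  filter_upwards [Measure.ae_ae_of_ae_prod h2] with y hy
  refine (Measure.ae_ae_comm (p := fun w z => P w y z) ?_).2 hy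
  have : Measurable fun q : EuclideanSpace ℝ (Fin m) × EuclideanSpace ℝ (Fin m) =>
      (q.1, (y, q.2)) := by fun_prop
  exact this hmeas

/-- This is the doubled Poincaré inequality on almost every slice, integrated over `y`. The total
mass on its right-hand side cancels the normalization of the conditional density. -/
theorem lintegral_condLaw_le (hW : W ∈ Matrix.orthogonalGroup (Fin (k + m)) ℝ)
    {ρ : EuclideanSpace ℝ (Fin (k + m)) → ℝ} (hρ : Measurable ρ) (hρ0 : ∀ x, 0 ≤ ρ x)
    {C : ENNReal}
    (hB : ∀ y : EuclideanSpace ℝ (Fin k),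
      BridgeBound (fun z : EuclideanSpace ℝ (Fin m) => ENNReal.ofReal (ρ (point W y z))) C)
    {f : EuclideanSpace ℝ (Fin (k + m)) → ℝ} (hf : Measurable f)
    {D : EuclideanSpace ℝ (Fin (k + m)) → EuclideanSpace ℝ (Fin (k + m))} (hD : Measurable D)
    (hpath : ∀ v, ∀ᵐ x, ENNReal.ofReal (ρ x) ≠ 0 → ENNReal.ofReal (ρ (x + v)) ≠ 0 →
      ENNReal.ofReal ((f (x + v) - f x) ^ 2)
      ≤ pathConst * ∫⁻ s in Set.Ioo (0 : ℝ) 1,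
          ENNReal.ofReal (pathWeight s * inner ℝ (D (x + s • v)) v ^ 2)) :
    ∫⁻ y, ∫⁻ z, ENNReal.ofReal (ρ (point W y z)) *
      ∫⁻ z', ENNReal.ofReal ((f (point W y z') - f (point W y z)) ^ 2) ∂condLaw ρ W y
      ≤ pathConst ^ 2 * C *
        ∫⁻ x, ENNReal.ofReal (ρ x) * ENNReal.ofReal (‖inactiveVar W (D x)‖ ^ 2) := by
  rw [lintegral_point hW (by fun_prop), ← lintegral_const_mul _ (by
    have : Measurable fun p : EuclideanSpace ℝ (Fin k) × EuclideanSpace ℝ (Fin m) =>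
      ENNReal.ofReal (ρ (point W p.1 p.2)) *
        ENNReal.ofReal (‖inactiveVar W (D (point W p.1 p.2))‖ ^ 2) := by
      have := (continuous_point W).measurable
      fun_prop
    exact this.lintegral_prod_right')]
  refine lintegral_mono_ae ?_
  filter_upwards [ae_slice_path hW hρ.ennreal_ofReal hf hD hpath] with y hy
  have hpt : Measurable fun z : EuclideanSpace ℝ (Fin m) => point W y z :=
    measurable_point_comp measurable_const measurable_id
  have hmain := (hB y).lintegral_sq_sub_le (by fun_prop) (h := fun z => f (point W y z))
    (hf.comp hpt) (p := fun z => inactiveVar W (D (point W y z))) (by fun_prop) hy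
  have hcond : Measurable (condDensity ρ W y) := by
    unfold condDensity
    fun_prop
  -- The marginal is also `0` by convention on a non-integrable slice. In either case division by
  -- zero makes the conditional law `0`, and the left-hand side vanishes.
  rcases eq_or_ne (marginalDensity ρ W y) 0 with h0 | h0
  · have : condLaw ρ W y = 0 := by
      simp [condLaw, condDensity, h0]
    simp [this]
  have hpos : 0 < marginalDensity ρ W y :=
    lt_of_le_of_ne (integral_nonneg fun z => hρ0 _) (Ne.symm h0)
  have hint : Integrable fun z : EuclideanSpace ℝ (Fin m) => ρ (point W y z) :=
    Integrable.of_integral_ne_zero h0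
  have hR : ∫⁻ z : EuclideanSpace ℝ (Fin m), ENNReal.ofReal (ρ (point W y z))
      = ENNReal.ofReal (marginalDensity ρ W y) :=
    (ofReal_integral_eq_lintegral_ofReal hint (Eventually.of_forall fun z => hρ0 _)).symm
  have e1 : ∀ z, ∫⁻ z', ENNReal.ofReal ((f (point W y z') - f (point W y z)) ^ 2) ∂condLaw ρ W y
      = (ENNReal.ofReal (marginalDensity ρ W y))⁻¹ * ∫⁻ z', ENNReal.ofReal (ρ (point W y z')) *
        ENNReal.ofReal ((f (point W y z') - f (point W y z)) ^ 2) := by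
    intro z
    rw [condLaw, lintegral_withDensity_eq_lintegral_mul _ hcond.ennreal_ofReal (by fun_prop),
      ← lintegral_const_mul _ (by fun_prop)]
    refine lintegral_congr fun z' => ?_
    rw [Pi.mul_apply, condDensity, ENNReal.ofReal_div_of_pos hpos, ENNReal.div_eq_inv_mul, mul_assoc]
  have hne : ENNReal.ofReal (marginalDensity ρ W y) ≠ 0 := (ENNReal.ofReal_pos.2 hpos).ne'
  calc _ = (ENNReal.ofReal (marginalDensity ρ W y))⁻¹ * ∫⁻ z, ENNReal.ofReal (ρ (point W y z)) *
        ∫⁻ z', ENNReal.ofReal (ρ (point W y z')) *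
        ENNReal.ofReal ((f (point W y z') - f (point W y z)) ^ 2) := by
        have : Measurable fun z => ∫⁻ z', ENNReal.ofReal (ρ (point W y z')) *
            ENNReal.ofReal ((f (point W y z') - f (point W y z)) ^ 2) := by
          have : Measurable fun q : EuclideanSpace ℝ (Fin m) × EuclideanSpace ℝ (Fin m) =>
            ENNReal.ofReal (ρ (point W y q.2)) *
            ENNReal.ofReal ((f (point W y q.2) - f (point W y q.1)) ^ 2) := by fun_prop
          exact this.lintegral_prod_right'
        rw [← lintegral_const_mul _ (by fun_prop)]
        refine lintegral_congr fun z => ?_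
        rw [e1]; ring
    _ ≤ (ENNReal.ofReal (marginalDensity ρ W y))⁻¹ * (pathConst ^ 2 * C *
        (ENNReal.ofReal (marginalDensity ρ W y) * ∫⁻ z, ENNReal.ofReal (ρ (point W y z)) *
          ENNReal.ofReal (‖inactiveVar W (D (point W y z))‖ ^ 2))) := by
        rw [← hR]
        exact mul_le_mul_right hmain _
    _ = ((ENNReal.ofReal (marginalDensity ρ W y))⁻¹ * ENNReal.ofReal (marginalDensity ρ W y)) *
        (pathConst ^ 2 * C * ∫⁻ z, ENNReal.ofReal (ρ (point W y z)) *
          ENNReal.ofReal (‖inactiveVar W (D (point W y z))‖ ^ 2)) := by ring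
    _ = _ := by rw [ENNReal.inv_mul_cancel hne ENNReal.ofReal_ne_top, one_mul]

end Slices

/-! ### Admissible priors, the gradient and integrability -/

section Prior

variable {n : ℕ} {ρ : EuclideanSpace ℝ (Fin n) → ℝ}

theorem stdGaussianDensity_eq (n : ℕ) : stdGaussianDensity n
    = fun x => (√(2 * Real.pi) ^ n)⁻¹ * Real.exp (-‖x‖ ^ 2 / 2) := rfl

theorem stdGaussianDensity_pos (n : ℕ) (x : EuclideanSpace ℝ (Fin n)) :
    0 < stdGaussianDensity n x := by
  have := Real.pi_pos
  unfold stdGaussianDensity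
  positivity

theorem integral_stdGaussianDensity (n : ℕ) : ∫ x, stdGaussianDensity n x = 1 := by
  have h := GaussianFourier.integral_rexp_neg_mul_sq_norm (V := EuclideanSpace ℝ (Fin n))
    (b := 1 / 2) (by norm_num)
  have e : ∀ x : EuclideanSpace ℝ (Fin n), -‖x‖ ^ 2 / 2 = -(1 / 2) * ‖x‖ ^ 2 := fun x => by ring
  have hpi := Real.pi_pos
  simp only [stdGaussianDensity, e]
  rw [integral_const_mul, h, finrank_euclideanSpace, Fintype.card_fin,
    show Real.pi / (1 / 2) = 2 * Real.pi by ring, Real.sqrt_eq_rpow, ← Real.rpow_natCast,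
    ← Real.rpow_mul (by positivity), show (1 / 2 : ℝ) * n = n / 2 by ring,
    inv_mul_cancel₀ (by positivity)]

theorem volume_real_pos_of_isOpen {S : Set (EuclideanSpace ℝ (Fin n))} (hS : IsOpen S)
    (hne : S.Nonempty) (hb : Bornology.IsBounded S) : 0 < volume.real S :=
  ENNReal.toReal_pos (hS.measure_pos volume hne).ne' hb.measure_lt_top.ne

theorem posSet_uniformDensity {S : Set (EuclideanSpace ℝ (Fin n))} (hS : IsOpen S)
    (hne : S.Nonempty) (hb : Bornology.IsBounded S) : posSet (uniformDensity S) = S := by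
  ext x
  have := volume_real_pos_of_isOpen hS hne hb
  by_cases hx : x ∈ S <;> simp [posSet, uniformDensity, hx, this]

theorem posSet_stdGaussianDensity (n : ℕ) : posSet (stdGaussianDensity n) = Set.univ :=
  Set.eq_univ_of_forall (stdGaussianDensity_pos n)

namespace ActiveSubspace.IsAdmissiblePrior

theorem nonneg (h : IsAdmissiblePrior ρ) (x : EuclideanSpace ℝ (Fin n)) : 0 ≤ ρ x := by
  rcases h with ⟨S, hS, hne, hb, hc, rfl⟩ | rfl
  · exact Set.indicator_nonneg (fun _ _ => inv_nonneg.2 measureReal_nonneg) x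
  · exact (stdGaussianDensity_pos n x).le

theorem measurable (h : IsAdmissiblePrior ρ) : Measurable ρ := by
  rcases h with ⟨S, hS, hne, hb, hc, rfl⟩ | rfl
  · exact measurable_const.indicator hS.measurableSet
  · rw [stdGaussianDensity_eq]; fun_prop

theorem isOpen_posSet (h : IsAdmissiblePrior ρ) : IsOpen (posSet ρ) := by
  rcases h with ⟨S, hS, hne, hb, hc, rfl⟩ | rfl
  · rwa [posSet_uniformDensity hS hne hb]
  · rw [posSet_stdGaussianDensity]; exact isOpen_univ

theorem convex_posSet (h : IsAdmissiblePrior ρ) : Convex ℝ (posSet ρ) := by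
  rcases h with ⟨S, hS, hne, hb, hc, rfl⟩ | rfl
  · rwa [posSet_uniformDensity hS hne hb]
  · rw [posSet_stdGaussianDensity]; exact convex_univ

theorem integral_eq_one (h : IsAdmissiblePrior ρ) : ∫ x, ρ x = 1 := by
  rcases h with ⟨S, hS, hne, hb, hc, rfl⟩ | rfl
  · have := volume_real_pos_of_isOpen hS hne hb
    rw [uniformDensity, integral_indicator hS.measurableSet, setIntegral_const, smul_eq_mul,
      mul_inv_cancel₀ this.ne']
  · exact integral_stdGaussianDensity n

theorem integrable (h : IsAdmissiblePrior ρ) : Integrable ρ :=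
  Integrable.of_integral_ne_zero (by rw [h.integral_eq_one]; exact one_ne_zero)

theorem lintegral_eq_one (h : IsAdmissiblePrior ρ) : ∫⁻ x, ENNReal.ofReal (ρ x) = 1 := by
  rw [← ofReal_integral_eq_lintegral_ofReal h.integrable (Eventually.of_forall h.nonneg),
    h.integral_eq_one, ENNReal.ofReal_one]

theorem exists_pos_le_of_isCompact (h : IsAdmissiblePrior ρ) {K : Set (EuclideanSpace ℝ (Fin n))}
    (hK : IsCompact K) (hKρ : K ⊆ posSet ρ) : ∃ c, 0 < c ∧ ∀ x ∈ K, c ≤ ρ x := by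
  have hcont : ContinuousOn ρ (posSet ρ) := by
    rcases h with ⟨S, hS, hne, hb, hc, rfl⟩ | rfl
    · rw [posSet_uniformDensity hS hne hb]
      exact continuousOn_const.congr fun x hx => Set.indicator_of_mem hx _
    · rw [stdGaussianDensity_eq]
      fun_prop
  rcases K.eq_empty_or_nonempty with rfl | hne
  · exact ⟨1, one_pos, by simp⟩
  obtain ⟨x, hx, hmin⟩ := hK.exists_isMinOn hne (hcont.mono hKρ)
  exact ⟨ρ x, hKρ hx, fun y hy => hmin hy⟩

theorem exists_bridgeBound (h : IsAdmissiblePrior ρ) :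
    ∃ C : ENNReal, C ≠ ⊤ ∧ BridgeBound (fun x => ENNReal.ofReal (ρ x)) C := by
  rcases h with ⟨S, hS, hne, hb, hc, rfl⟩ | rfl
  · refine ⟨ENNReal.ofReal (Metric.diam S ^ 2 * 2 ^ Module.finrank ℝ (EuclideanSpace ℝ (Fin n))),
      ENNReal.ofReal_ne_top, ?_⟩
    have e : (fun x => ENNReal.ofReal (uniformDensity S x))
        = S.indicator fun _ => ENNReal.ofReal (volume.real S)⁻¹ := by
      ext x
      by_cases hx : x ∈ S <;> simp [uniformDensity, hx]
    rw [e]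
    refine bridgeBound_indicator hS.measurableSet hc (R := Metric.diam S) (fun x hx y hy => ?_) _
    rw [← dist_eq_norm]
    exact Metric.dist_le_diam_of_mem hb hy hx
  · exact ⟨_, ENNReal.ofReal_ne_top, bridgeBound_gaussian _ (by positivity)⟩

/-- Slices of a convex set are convex with diameter at most that of the set, and slices of the
standard Gaussian are multiples of a standard Gaussian in dimension `m`. Hence one constant serves
every rotation and every `y`, which is why the final constant depends on neither `f` nor the
rotation. -/
theorem exists_bridgeBound_slices {k m : ℕ} {ρ : EuclideanSpace ℝ (Fin (k + m)) → ℝ}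
    (h : IsAdmissiblePrior ρ) :
    ∃ C : ENNReal, C ≠ ⊤ ∧ ∀ W ∈ Matrix.orthogonalGroup (Fin (k + m)) ℝ,
      ∀ y : EuclideanSpace ℝ (Fin k),
        BridgeBound (fun z : EuclideanSpace ℝ (Fin m) => ENNReal.ofReal (ρ (point W y z))) C := by
  rcases h with ⟨S, hS, hne, hb, hc, rfl⟩ | rfl
  · refine ⟨ENNReal.ofReal (Metric.diam S ^ 2 * 2 ^ Module.finrank ℝ (EuclideanSpace ℝ (Fin m))),
      ENNReal.ofReal_ne_top, fun W hW y => ?_⟩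
    have hcont : Continuous fun z : EuclideanSpace ℝ (Fin m) => point W y z :=
      (continuous_point W).comp (by fun_prop : Continuous fun z => (y, z))
    have e : (fun z : EuclideanSpace ℝ (Fin m) => ENNReal.ofReal (uniformDensity S (point W y z)))
        = ((fun z => point W y z) ⁻¹' S).indicator fun _ => ENNReal.ofReal (volume.real S)⁻¹ := by
      ext z
      by_cases hx : point W y z ∈ S <;> simp [uniformDensity, hx]
    have hsub : ∀ z z' : EuclideanSpace ℝ (Fin m),
        point W y z' = point W y z + point W 0 (z' - z) := by
      intro z z'
      have := point_add_smul W y z (z' - z) 1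
      simpa using this
    rw [e]
    refine bridgeBound_indicator (hS.preimage hcont).measurableSet ?_ (R := Metric.diam S)
      (fun x hx z hz => ?_) _
    · intro z hz z' hz' a b ha hb hab
      have h1 := hc hz hz' ha hb hab
      have h2 : a • z + b • z' = z + b • (z' - z) := by
        rw [← sub_eq_iff_eq_add.2 hab.symm]; module
      have h3 : point W y (a • z + b • z') = a • point W y z + b • point W y z' := by
        rw [h2, point_add_smul, hsub z z', ← sub_eq_iff_eq_add.2 hab.symm]; module
      change point W y (a • z + b • z') ∈ S
      rw [h3]
      exact h1
    · have h1 : dist (point W y z) (point W y x) ≤ Metric.diam S :=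
        Metric.dist_le_diam_of_mem hb hz hx
      rw [dist_eq_norm, hsub x z, add_sub_cancel_left] at h1
      have h2 := norm_point_sq hW 0 (z - x)
      rw [norm_zero, zero_pow two_ne_zero, zero_add] at h2
      rwa [(sq_eq_sq₀ (norm_nonneg _) (norm_nonneg _)).1 h2] at h1
  · refine ⟨ENNReal.ofReal (2 * 2 ^ Module.finrank ℝ (EuclideanSpace ℝ (Fin m))),
      ENNReal.ofReal_ne_top, fun W hW y => ?_⟩
    have e : (fun z : EuclideanSpace ℝ (Fin m) =>
        ENNReal.ofReal (stdGaussianDensity (k + m) (point W y z)))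
        = fun z => ENNReal.ofReal (((√(2 * Real.pi) ^ (k + m))⁻¹ * Real.exp (-‖y‖ ^ 2 / 2)) *
          Real.exp (-‖z‖ ^ 2 / 2)) := by
      ext z
      rw [stdGaussianDensity, norm_point_sq hW, mul_assoc, ← Real.exp_add]
      congr 3
      ring
    rw [e]
    exact bridgeBound_gaussian _ (by positivity)

end ActiveSubspace.IsAdmissiblePrior

/-- The gradient of `f` on `{ρ > 0}`, extended by zero. -/
noncomputable def gradOn (ρ f : EuclideanSpace ℝ (Fin n) → ℝ) (x : EuclideanSpace ℝ (Fin n)) :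
    EuclideanSpace ℝ (Fin n) :=
  (posSet ρ).indicator (fun x => WithLp.toLp 2 fun i => partialDeriv f i x) x

theorem gradOn_apply {f : EuclideanSpace ℝ (Fin n) → ℝ} {x : EuclideanSpace ℝ (Fin n)}
    (hx : x ∈ posSet ρ) (i : Fin n) : gradOn ρ f x i = partialDeriv f i x := by
  simp [gradOn, hx]

theorem measurable_indicator_of_subtype {α : Type*} [MeasurableSpace α] {s : Set α}
    (hs : MeasurableSet s) {f : α → ℝ} (hf : Measurable fun x : s => f x) :
    Measurable (s.indicator f) := by
  refine measurable_of_restrict_of_restrict_compl hs ?_ ?_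
  · convert hf using 1
    ext x
    simp
  · convert (measurable_const : Measurable fun _ : (sᶜ : Set α) => (0 : ℝ)) using 1
    ext x
    exact Set.indicator_of_notMem x.2 f

theorem hasLineDerivAt_indicator (hΩ : IsOpen (posSet ρ)) {f : EuclideanSpace ℝ (Fin n) → ℝ}
    (hf : HasSqIntegrablePartials ρ f) {x : EuclideanSpace ℝ (Fin n)} (hx : x ∈ posSet ρ)
    (i : Fin n) :
    HasLineDerivAt ℝ ((posSet ρ).indicator f) (gradOn ρ f x i) x (EuclideanSpace.single i 1) := by
  rw [gradOn_apply hx]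
  refine ((hf i).1 x hx).hasLineDerivAt.congr_of_eventuallyEq ?_
  filter_upwards [hΩ.mem_nhds hx] with y hy
  simp [hy]

/-- On the open set the partial derivatives are pointwise limits of difference quotients of the zero
extension of `f`, with steps `1/(j+1)`. -/
theorem measurable_gradOn (hΩ : IsOpen (posSet ρ)) {f : EuclideanSpace ℝ (Fin n) → ℝ}
    (hfm : Measurable fun x : posSet ρ => f x) (hf : HasSqIntegrablePartials ρ f) :
    Measurable (gradOn ρ f) := by
  have hF := measurable_indicator_of_subtype hΩ.measurableSet hfm
  set F := (posSet ρ).indicator f with hFdef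
  have hcoord : ∀ i, Measurable fun x => gradOn ρ f x i := by
    intro i
    refine measurable_of_tendsto_metrizable (f := fun (j : ℕ) x => (posSet ρ).indicator (fun x =>
      (j + 1 : ℝ) * (F (x + (j + 1 : ℝ)⁻¹ • EuclideanSpace.single i 1) - F x)) x)
      (fun j => Measurable.indicator (by fun_prop) hΩ.measurableSet) ?_
    rw [tendsto_pi_nhds]
    intro x
    by_cases hx : x ∈ posSet ρ
    · have h1 := (hasLineDerivAt_indicator hΩ hf hx i).tendsto_slope_zero
      have h2 : Tendsto (fun j : ℕ => ((j : ℝ) + 1)⁻¹) atTop (𝓝[≠] 0) := by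
        refine tendsto_nhdsWithin_iff.2 ⟨?_, Eventually.of_forall fun j => ?_⟩
        · simpa using tendsto_one_div_add_atTop_nhds_zero_nat (𝕜 := ℝ)
        · have : (j : ℝ) + 1 ≠ 0 := by positivity
          simpa using this
      have h3 := h1.comp h2
      simpa [hx, Function.comp_def, hFdef] using h3
    · simp [gradOn, hx]
  have : gradOn ρ f = fun x => WithLp.toLp 2 fun i => gradOn ρ f x i := rfl
  rw [this]
  exact (PiLp.continuous_toLp 2 _).measurable.comp (measurable_pi_lambda _ hcoord)

theorem integrable_gradOn_mul (hΩ : IsOpen (posSet ρ)) (hρm : Measurable ρ) (hρ : ∀ x, 0 ≤ ρ x)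
    {f : EuclideanSpace ℝ (Fin n) → ℝ}
    (hfm : Measurable fun x : posSet ρ => f x) (hf : HasSqIntegrablePartials ρ f) (i j : Fin n) :
    Integrable fun x => gradOn ρ f x i * gradOn ρ f x j * ρ x := by
  have hD := measurable_gradOn hΩ hfm hf
  have hsq : ∀ i, Integrable fun x => gradOn ρ f x i ^ 2 * ρ x := by
    intro i
    rw [← integrableOn_iff_integrable_of_support_subset (s := posSet ρ)]
    · refine ((hf i).2).congr_fun (fun x hx => ?_) hΩ.measurableSet
      simp only [gradOn_apply hx]
    · intro x hx
      by_contra h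
      exact hx (by simp [gradOn, h])
  refine Integrable.mono' ((hsq i).add (hsq j)) (by fun_prop) (Eventually.of_forall fun x => ?_)
  rw [norm_mul, Real.norm_of_nonneg (hρ x), Pi.add_apply, ← add_mul]
  refine mul_le_mul_of_nonneg_right ?_ (hρ x)
  rw [Real.norm_eq_abs, abs_mul]
  nlinarith [sq_nonneg (|gradOn ρ f x i| - |gradOn ρ f x j|), sq_abs (gradOn ρ f x i),
    sq_abs (gradOn ρ f x j), abs_nonneg (gradOn ρ f x i), abs_nonneg (gradOn ρ f x j)]

theorem integrable_norm_gradOn_sq_mul (hΩ : IsOpen (posSet ρ)) (hρm : Measurable ρ)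
    (hρ : ∀ x, 0 ≤ ρ x) {f : EuclideanSpace ℝ (Fin n) → ℝ}
    (hfm : Measurable fun x : posSet ρ => f x) (hf : HasSqIntegrablePartials ρ f) :
    Integrable fun x => ‖gradOn ρ f x‖ ^ 2 * ρ x := by
  simp only [EuclideanSpace.real_norm_sq_eq, Finset.sum_mul]
  simp only [sq]
  exact integrable_finsetSum _ fun i _ => integrable_gradOn_mul hΩ hρm hρ hfm hf i i

theorem gradOuterProduct_apply (hΩ : IsOpen (posSet ρ)) (f : EuclideanSpace ℝ (Fin n) → ℝ)
    (i j : Fin n) :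
    gradOuterProduct ρ f i j = ∫ x, gradOn ρ f x i * gradOn ρ f x j * ρ x := by
  rw [gradOuterProduct, Matrix.of_apply, ← setIntegral_eq_integral_of_forall_compl_eq_zero
    (s := posSet ρ) (f := fun x => gradOn ρ f x i * gradOn ρ f x j * ρ x)]
  · refine setIntegral_congr_fun hΩ.measurableSet fun x hx => ?_
    simp only [gradOn_apply hx]
  · intro x hx
    simp [gradOn, hx]

/-- On a compact subset `ρ` is bounded below, so square integrability for `ρ` passes to Lebesgue
measure, and `‖D‖ ≤ 1 + ‖D‖²`. -/
theorem ActiveSubspace.IsAdmissiblePrior.integrableOn_gradOn (h : IsAdmissiblePrior ρ)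
    {f : EuclideanSpace ℝ (Fin n) → ℝ}
    (hfm : Measurable fun x : posSet ρ => f x) (hf : HasSqIntegrablePartials ρ f)
    {K : Set (EuclideanSpace ℝ (Fin n))} (hKρ : K ⊆ posSet ρ) (hK : IsCompact K) :
    IntegrableOn (gradOn ρ f) K := by
  obtain ⟨c, hc, hcK⟩ := h.exists_pos_le_of_isCompact hK hKρ
  have h1 := integrable_norm_gradOn_sq_mul h.isOpen_posSet h.measurable h.nonneg hfm hf
  have h2 : IntegrableOn (fun _ : EuclideanSpace ℝ (Fin n) => (1 : ℝ)) K :=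
    integrableOn_const hK.measure_lt_top.ne
  refine Integrable.mono' (h2.add ((h1.const_mul c⁻¹).integrableOn (s := K)))
    (measurable_gradOn h.isOpen_posSet hfm hf).aestronglyMeasurable ?_
  filter_upwards [ae_restrict_mem hK.measurableSet] with x hx
  have h3 : ‖gradOn ρ f x‖ ^ 2 ≤ c⁻¹ * (‖gradOn ρ f x‖ ^ 2 * ρ x) := by
    rw [← mul_assoc, mul_comm c⁻¹, mul_assoc]
    refine le_mul_of_one_le_right (sq_nonneg _) ?_
    rw [← div_eq_inv_mul, one_le_div hc]
    exact hcK x hx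
  simp only [Pi.add_apply]
  nlinarith [sq_nonneg (‖gradOn ρ f x‖ - 1), norm_nonneg (gradOn ρ f x)]

theorem ActiveSubspace.IsAdmissiblePrior.ae_path (h : IsAdmissiblePrior ρ)
    {f : EuclideanSpace ℝ (Fin n) → ℝ} (hf0 : ∀ x, 0 ≤ f x)
    (hfm : Measurable fun x : posSet ρ => f x) (hf : HasSqIntegrablePartials ρ f)
    (v : EuclideanSpace ℝ (Fin n)) :
    ∀ᵐ x, ENNReal.ofReal (ρ x) ≠ 0 → ENNReal.ofReal (ρ (x + v)) ≠ 0 →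
      ENNReal.ofReal (((posSet ρ).indicator f (x + v) - (posSet ρ).indicator f x) ^ 2)
      ≤ pathConst * ∫⁻ s in Set.Ioo (0 : ℝ) 1,
          ENNReal.ofReal (pathWeight s * inner ℝ (gradOn ρ f (x + s • v)) v ^ 2) := by
  filter_upwards [ae_ofReal_sub_sq_le_path h.isOpen_posSet h.convex_posSet
    (measurable_indicator_of_subtype h.isOpen_posSet.measurableSet hfm)
    (Set.indicator_nonneg fun x _ => hf0 x) (measurable_gradOn h.isOpen_posSet hfm hf)
    (fun K hK hKc => h.integrableOn_gradOn hfm hf hK hKc)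
    (fun x hx i => hasLineDerivAt_indicator h.isOpen_posSet hf hx i) v] with x hx h1 h2
  have e : ∀ y, ENNReal.ofReal (ρ y) ≠ 0 → y ∈ posSet ρ := fun y hy =>
    ENNReal.ofReal_pos.1 (pos_iff_ne_zero.2 hy)
  exact hx (e _ h1) (e _ h2)

/-- The doubled Poincaré inequality on the whole space makes `∫∫ ρ(z) ρ(z') (F z' - F z)²` finite.
As `ρ` has mass `1`, some `z` has a finite inner integral, and then `F ≤ 1 + F z + (F - F z)²`. -/
theorem ActiveSubspace.IsAdmissiblePrior.integrable_mul (h : IsAdmissiblePrior ρ)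
    {f : EuclideanSpace ℝ (Fin n) → ℝ} (hf0 : ∀ x, 0 ≤ f x)
    (hfm : Measurable fun x : posSet ρ => f x) (hf : HasSqIntegrablePartials ρ f) :
    Integrable fun x => (posSet ρ).indicator f x * ρ x := by
  have hF := measurable_indicator_of_subtype h.isOpen_posSet.measurableSet hfm
  have hD := measurable_gradOn h.isOpen_posSet hfm hf
  have hρm := h.measurable
  set F := (posSet ρ).indicator f with hFdef
  obtain ⟨C, hC, hB⟩ := h.exists_bridgeBound
  have h1 := hB.lintegral_sq_sub_le (by fun_prop) hF hD
    (Eventually.of_forall fun w => h.ae_path hf0 hfm hf w)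
  have hfin : ∫⁻ x, ENNReal.ofReal (ρ x) * ENNReal.ofReal (‖gradOn ρ f x‖ ^ 2) ≠ ⊤ := by
    have := (integrable_norm_gradOn_sq_mul h.isOpen_posSet hρm h.nonneg hfm hf).lintegral_lt_top.ne
    refine (lintegral_congr fun x => ?_).trans_ne this
    rw [mul_comm, ENNReal.ofReal_mul (sq_nonneg _)]
  have h2 : ∫⁻ z, ENNReal.ofReal (ρ z) * ∫⁻ z', ENNReal.ofReal (ρ z') *
      ENNReal.ofReal ((F z' - F z) ^ 2) ≠ ⊤ := by
    refine ne_top_of_le_ne_top ?_ h1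
    rw [h.lintegral_eq_one, one_mul]
    exact ENNReal.mul_ne_top (ENNReal.mul_ne_top (ENNReal.pow_ne_top pathConst_ne_top) hC) hfin
  have hm : Measurable fun z => ∫⁻ z', ENNReal.ofReal (ρ z') * ENNReal.ofReal ((F z' - F z) ^ 2) := by
    have : Measurable fun q : EuclideanSpace ℝ (Fin n) × EuclideanSpace ℝ (Fin n) =>
      ENNReal.ofReal (ρ q.2) * ENNReal.ofReal ((F q.2 - F q.1) ^ 2) := by fun_prop
    exact this.lintegral_prod_right'
  have h3 := ae_lt_top (by fun_prop) h2
  obtain ⟨z, hz, hzt⟩ : ∃ z, ENNReal.ofReal (ρ z) ≠ 0 ∧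
      ∫⁻ z', ENNReal.ofReal (ρ z') * ENNReal.ofReal ((F z' - F z) ^ 2) < ⊤ := by
    by_contra hcon
    push Not at hcon
    have : ∫⁻ x, ENNReal.ofReal (ρ x) = 0 := by
      rw [lintegral_eq_zero_iff (by fun_prop)]
      filter_upwards [h3] with z hz
      by_contra hne
      have := top_le_iff.1 (hcon z hne)
      rw [this, ENNReal.mul_top hne] at hz
      exact lt_irrefl _ hz
    rw [h.lintegral_eq_one] at this
    exact one_ne_zero this
  have h4 : Integrable fun z' => ρ z' * (F z' - F z) ^ 2 := by
    refine (lintegral_ofReal_ne_top_iff_integrable (by fun_prop)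
      (Eventually.of_forall fun z' => mul_nonneg (h.nonneg _) (sq_nonneg _))).1 ?_
    simpa only [ENNReal.ofReal_mul (h.nonneg _)] using hzt.ne
  refine Integrable.mono' ((h.integrable.const_mul (1 + F z)).add h4) (by fun_prop)
    (Eventually.of_forall fun x => ?_)
  have hFx : 0 ≤ F x := Set.indicator_nonneg (fun x _ => hf0 x) x
  rw [Real.norm_of_nonneg (mul_nonneg hFx (h.nonneg x)), Pi.add_apply, mul_comm (ρ x), ← add_mul]
  exact mul_le_mul_of_nonneg_right (by nlinarith [sq_nonneg (F x - F z - 1)]) (h.nonneg x)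

end Prior

/-! ### Stability of the posterior in the Hellinger distance -/

section Hellinger

variable {n : ℕ} {ρ f g : EuclideanSpace ℝ (Fin n) → ℝ}

theorem integrable_exp_neg_mul (hρm : Measurable ρ) (hρ : ∀ x, 0 ≤ ρ x) (hρi : Integrable ρ)
    (hf : Measurable f) (hf0 : ∀ x, 0 ≤ f x) : Integrable fun x => Real.exp (-f x) * ρ x := by
  refine hρi.mono' (by fun_prop) (Eventually.of_forall fun x => ?_)
  rw [Real.norm_of_nonneg (mul_nonneg (Real.exp_pos _).le (hρ x))]
  exact mul_le_of_le_one_left (hρ x) (Real.exp_le_one_iff.2 (neg_nonpos.2 (hf0 x)))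

/-- Jensen's inequality, from the tangent to the exponential at `-∫ f ρ`. -/
theorem exp_neg_integral_le_normConst (hρm : Measurable ρ) (hρ : ∀ x, 0 ≤ ρ x)
    (hρi : Integrable ρ) (hρ1 : ∫ x, ρ x = 1) (hf : Measurable f) (hf0 : ∀ x, 0 ≤ f x)
    (hfi : Integrable fun x => f x * ρ x) :
    Real.exp (-∫ x, f x * ρ x) ≤ normConst ρ f := by
  set F := ∫ x, f x * ρ x with hF
  have h1 : ∫ x, (Real.exp (-F) * (1 + F) * ρ x - Real.exp (-F) * (f x * ρ x)) ≤ normConst ρ f := by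
    refine integral_mono ((hρi.const_mul _).sub (hfi.const_mul _))
      (integrable_exp_neg_mul hρm hρ hρi hf hf0) fun x => ?_
    have h2 : Real.exp (-F) * (1 + F - f x) ≤ Real.exp (-f x) := by
      rw [show -f x = -F + (F - f x) by ring, Real.exp_add]
      have := Real.add_one_le_exp (F - f x)
      gcongr
      linarith
    have := mul_le_mul_of_nonneg_right h2 (hρ x)
    calc _ = Real.exp (-F) * (1 + F - f x) * ρ x := by ring
      _ ≤ _ := this
  rw [integral_sub (hρi.const_mul _) (hfi.const_mul _), integral_const_mul, integral_const_mul,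
    hρ1, ← hF] at h1
  linarith

theorem normConst_le_one (hρm : Measurable ρ) (hρ : ∀ x, 0 ≤ ρ x)
    (hρi : Integrable ρ) (hρ1 : ∫ x, ρ x = 1) (hf : Measurable f) (hf0 : ∀ x, 0 ≤ f x) :
    normConst ρ f ≤ 1 := by
  rw [← hρ1]
  refine integral_mono (integrable_exp_neg_mul hρm hρ hρi hf hf0) hρi fun x => ?_
  exact mul_le_of_le_one_left (hρ x) (Real.exp_le_one_iff.2 (neg_nonpos.2 (hf0 x)))

theorem sq_exp_sub_exp_le {a b : ℝ} (ha : 0 ≤ a) (hb : 0 ≤ b) :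
    (Real.exp (-a / 2) - Real.exp (-b / 2)) ^ 2 ≤ (a - b) ^ 2 / 4 := by
  have key : ∀ a b : ℝ, 0 ≤ a → a ≤ b →
      (Real.exp (-a / 2) - Real.exp (-b / 2)) ^ 2 ≤ (a - b) ^ 2 / 4 := by
    intro a b ha hab
    have h1 : Real.exp (-b / 2) ≤ Real.exp (-a / 2) := Real.exp_le_exp.2 (by linarith)
    have h2 : Real.exp (-a / 2) - Real.exp (-b / 2) ≤ (b - a) / 2 := by
      have e : Real.exp (-b / 2) = Real.exp (-a / 2) * Real.exp (-(b - a) / 2) := by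
        rw [← Real.exp_add]; congr 1; ring
      have h3 := Real.add_one_le_exp (-(b - a) / 2)
      have h4 : Real.exp (-a / 2) ≤ 1 := Real.exp_le_one_iff.2 (by linarith)
      have h5 := Real.exp_pos (-a / 2)
      rw [e]
      nlinarith
    nlinarith
  rcases le_total a b with h | h
  · exact key a b ha h
  · have := key b a hb h
    nlinarith

/-- Let `a`, `b` be the square roots of the unnormalized posteriors, with `L²` norms `A`, `B`. The
integral equals `2 - 2⟨a,b⟩/(AB)`, which is at most `2` because `a, b ≥ 0`. Multiplied by `AB`, it
is at most `A² + B² - 2⟨a,b⟩ = ‖a - b‖²`, so the difference of the normalizing constants needs no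
separate estimate. -/
theorem integral_sqrt_posterior_sub_sq_le (hρm : Measurable ρ) (hρ : ∀ x, 0 ≤ ρ x)
    (hρi : Integrable ρ) (hf : Measurable f) (hf0 : ∀ x, 0 ≤ f x)
    (hg : Measurable g) (hg0 : ∀ x, 0 ≤ g x) (hZf : 0 < normConst ρ f) (hZg : 0 < normConst ρ g)
    (hd : Integrable fun x => (f x - g x) ^ 2 * ρ x) :
    ∫ x, (√(posterior ρ f x) - √(posterior ρ g x)) ^ 2 ≤ 2 ∧
    ∫ x, (√(posterior ρ f x) - √(posterior ρ g x)) ^ 2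
      ≤ 1 / 4 * (∫ x, (f x - g x) ^ 2 * ρ x) / (√(normConst ρ f) * √(normConst ρ g)) := by
  set a : EuclideanSpace ℝ (Fin n) → ℝ := fun x => Real.exp (-f x / 2) * √(ρ x) with ha
  set b : EuclideanSpace ℝ (Fin n) → ℝ := fun x => Real.exp (-g x / 2) * √(ρ x) with hb
  set A := √(normConst ρ f)
  set B := √(normConst ρ g)
  have hA : 0 < A := Real.sqrt_pos.2 hZf
  have hBp : 0 < B := Real.sqrt_pos.2 hZg
  have hA2 : A ^ 2 = normConst ρ f := Real.sq_sqrt hZf.le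
  have hB2 : B ^ 2 = normConst ρ g := Real.sq_sqrt hZg.le
  have hexp : ∀ t : ℝ, Real.exp (-t / 2) ^ 2 = Real.exp (-t) := fun t => by
    rw [← Real.exp_nat_mul]; congr 1; push_cast; ring
  have ha2 : ∀ x, a x ^ 2 = Real.exp (-f x) * ρ x := fun x => by
    rw [ha, mul_pow, hexp, Real.sq_sqrt (hρ x)]
  have hb2 : ∀ x, b x ^ 2 = Real.exp (-g x) * ρ x := fun x => by
    rw [hb, mul_pow, hexp, Real.sq_sqrt (hρ x)]
  have ha0 : ∀ x, 0 ≤ a x := fun x => by positivity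
  have hb0 : ∀ x, 0 ≤ b x := fun x => by positivity
  have hai : Integrable fun x => a x ^ 2 := by
    simpa only [ha2] using integrable_exp_neg_mul hρm hρ hρi hf hf0
  have hbi : Integrable fun x => b x ^ 2 := by
    simpa only [hb2] using integrable_exp_neg_mul hρm hρ hρi hg hg0
  have hIa : ∫ x, a x ^ 2 = A ^ 2 := by simp only [ha2, hA2]; rfl
  have hIb : ∫ x, b x ^ 2 = B ^ 2 := by simp only [hb2, hB2]; rfl
  have habi : Integrable fun x => a x * b x := by
    refine (hai.add hbi).mono' (by fun_prop) (Eventually.of_forall fun x => ?_)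
    rw [Real.norm_of_nonneg (mul_nonneg (ha0 x) (hb0 x)), Pi.add_apply]
    nlinarith [sq_nonneg (a x - b x), ha0 x, hb0 x, mul_nonneg (ha0 x) (hb0 x)]
  have hpost : ∀ x, (√(posterior ρ f x) - √(posterior ρ g x)) ^ 2
      = a x ^ 2 / A ^ 2 + b x ^ 2 / B ^ 2 - 2 / (A * B) * (a x * b x) := by
    intro x
    have e1 : √(posterior ρ f x) = a x / A := by
      rw [ActiveSubspace.posterior, ← ha2, Real.sqrt_div (sq_nonneg _), Real.sqrt_sq (ha0 x)]
    have e2 : √(posterior ρ g x) = b x / B := by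
      rw [ActiveSubspace.posterior, ← hb2, Real.sqrt_div (sq_nonneg _), Real.sqrt_sq (hb0 x)]
    rw [e1, e2]
    field_simp
    ring
  have hI : ∫ x, (√(posterior ρ f x) - √(posterior ρ g x)) ^ 2
      = 2 - 2 / (A * B) * ∫ x, a x * b x := by
    simp only [hpost]
    have hs : Integrable fun x => a x ^ 2 / A ^ 2 + b x ^ 2 / B ^ 2 :=
      (hai.div_const _).add (hbi.div_const _)
    rw [integral_sub hs (habi.const_mul _),
      integral_add (hai.div_const _) (hbi.div_const _), integral_div, integral_div, hIa, hIb,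
      integral_const_mul, div_self (by positivity), div_self (by positivity)]
    norm_num
  have hab0 : 0 ≤ ∫ x, a x * b x := integral_nonneg fun x => mul_nonneg (ha0 x) (hb0 x)
  refine ⟨?_, ?_⟩
  · rw [hI]
    have : 0 ≤ 2 / (A * B) * ∫ x, a x * b x := by positivity
    linarith
  · have hdiff : A ^ 2 + B ^ 2 - 2 * ∫ x, a x * b x ≤ 1 / 4 * ∫ x, (f x - g x) ^ 2 * ρ x := by
      have hs : Integrable fun x => a x ^ 2 + b x ^ 2 := hai.add hbi
      rw [← hIa, ← hIb, ← integral_add hai hbi, ← integral_const_mul, ← integral_const_mul,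
        ← integral_sub hs (habi.const_mul _)]
      refine integral_mono (hs.sub (habi.const_mul _)) (hd.const_mul _) fun x => ?_
      have h1 := mul_le_mul_of_nonneg_right (sq_exp_sub_exp_le (hf0 x) (hg0 x)) (hρ x)
      have h2 : a x ^ 2 + b x ^ 2 - 2 * (a x * b x)
          = (Real.exp (-f x / 2) - Real.exp (-g x / 2)) ^ 2 * ρ x := by
        simp only [ha, hb]
        linear_combination (Real.exp (-f x / 2) - Real.exp (-g x / 2)) ^ 2 * Real.sq_sqrt (hρ x)
      simp only [h2]
      linarith
    rw [hI, le_div_iff₀ (by positivity)]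
    have : (2 - 2 / (A * B) * ∫ x, a x * b x) * (A * B) = 2 * (A * B) - 2 * ∫ x, a x * b x := by
      field_simp
    rw [this]
    nlinarith [sq_nonneg (A - B)]

theorem hellingerDist_posterior_le (hρm : Measurable ρ) (hρ : ∀ x, 0 ≤ ρ x)
    (hρi : Integrable ρ) (hρ1 : ∫ x, ρ x = 1) (hf : Measurable f) (hf0 : ∀ x, 0 ≤ f x)
    (hfi : Integrable fun x => f x * ρ x) (hg : Measurable g) (hg0 : ∀ x, 0 ≤ g x)
    (hd : Integrable fun x => (f x - g x) ^ 2 * ρ x) :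
    hellingerDist (posterior ρ f) (posterior ρ g)
      ≤ √8 * hellingerConst ρ f * √(∫ x, (f x - g x) ^ 2 * ρ x) := by
  set F := ∫ x, f x * ρ x with hF
  have hFpos : ∫ x in posSet ρ, f x * ρ x = F := by
    refine setIntegral_eq_integral_of_forall_compl_eq_zero fun x hx => ?_
    rw [le_antisymm (not_lt.1 hx) (hρ x), mul_zero]
  have hgi : Integrable fun x => g x * ρ x := by
    refine ((hfi.add hρi).add hd).mono' (by fun_prop) (Eventually.of_forall fun x => ?_)
    rw [Real.norm_of_nonneg (mul_nonneg (hg0 x) (hρ x))]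
    simp only [Pi.add_apply]
    calc g x * ρ x ≤ (f x + 1 + (f x - g x) ^ 2) * ρ x :=
          mul_le_mul_of_nonneg_right (by nlinarith [sq_nonneg (f x - g x + 1)]) (hρ x)
      _ = _ := by ring
  set G := ∫ x, g x * ρ x with hG
  set Δ := ∫ x, (f x - g x) ^ 2 * ρ x with hΔ
  have hΔ0 : 0 ≤ Δ := integral_nonneg fun x => mul_nonneg (sq_nonneg _) (hρ x)
  have hF0 : 0 ≤ F := integral_nonneg fun x => mul_nonneg (hf0 x) (hρ x)
  have hJf := exp_neg_integral_le_normConst hρm hρ hρi hρ1 hf hf0 hfi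
  have hJg := exp_neg_integral_le_normConst hρm hρ hρi hρ1 hg hg0 hgi
  have hZf1 := normConst_le_one hρm hρ hρi hρ1 hf hf0
  have hZf : 0 < normConst ρ f := (Real.exp_pos _).trans_le hJf
  have hZg : 0 < normConst ρ g := (Real.exp_pos _).trans_le hJg
  obtain ⟨h2, h4⟩ := integral_sqrt_posterior_sub_sq_le hρm hρ hρi hf hf0 hg hg0 hZf hZg hd
  set X := normConst ρ f * Real.exp (-F) with hX
  have hX0 : 0 < X := mul_pos hZf (Real.exp_pos _)
  have hX1 : X ≤ 1 := mul_le_one₀ hZf1 (Real.exp_pos _).le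
    (Real.exp_le_one_iff.2 (neg_nonpos.2 hF0))
  have hXr : X ^ (-(1 / 2) : ℝ) = (√X)⁻¹ := by
    rw [Real.rpow_neg hX0.le, Real.sqrt_eq_rpow]
  have hsX := Real.sqrt_pos.2 hX0
  have hsX1 : √X ≤ 1 := Real.sqrt_le_one.2 hX1
  rw [hellingerDist, hellingerConst, hFpos, ← hX, hXr, ← Real.sqrt_mul (by norm_num),
    ← Real.sqrt_mul (by positivity)]
  refine Real.sqrt_le_sqrt ?_
  have hmain : 8 * (1 / 8 * (√X)⁻¹) * Δ = Δ / √X := by field_simp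
  rw [hmain, le_div_iff₀ hsX]
  set I := ∫ x, (√(posterior ρ f x) - √(posterior ρ g x)) ^ 2
  have hI0 : 0 ≤ I := integral_nonneg fun x => sq_nonneg _
  -- If `G ≤ F + 1`, Jensen bounds the normalizing constant of `g` below by `exp(-F-1)`. Otherwise
  -- `Δ > 1` while `I ≤ 2` and `√X ≤ 1`.
  rcases le_or_gt G (F + 1) with h | h
  · have h5 : √X * Real.exp (-1 / 2) ≤ √(normConst ρ f) * √(normConst ρ g) := by
      rw [← Real.sqrt_mul hZf.le]
      refine Real.le_sqrt_of_sq_le ?_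
      rw [mul_pow, Real.sq_sqrt hX0.le, hX, mul_assoc, ← Real.exp_nat_mul, ← Real.exp_add]
      refine mul_le_mul_of_nonneg_left (le_trans ?_ hJg) hZf.le
      refine Real.exp_le_exp.2 ?_
      push_cast
      linarith
    have h6 : 1 / 2 ≤ Real.exp (-1 / 2) := by
      have := Real.add_one_le_exp (-1 / 2 : ℝ)
      linarith
    have h7 : 0 < √(normConst ρ f) * √(normConst ρ g) :=
      mul_pos (Real.sqrt_pos.2 hZf) (Real.sqrt_pos.2 hZg)
    rw [le_div_iff₀ h7] at h4
    have h8 : I * (√X * (1 / 2)) ≤ 1 / 4 * Δ :=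
      (mul_le_mul_of_nonneg_left ((mul_le_mul_of_nonneg_left h6 hsX.le).trans h5) hI0).trans h4
    linarith
  · have h5 : 2 * (G - F) - 1 ≤ Δ := by
      have hs : Integrable fun x => 2 * (g x * ρ x - f x * ρ x) := (hgi.sub hfi).const_mul 2
      have : ∫ x, (2 * (g x * ρ x - f x * ρ x) - ρ x) ≤ Δ := by
        refine integral_mono (hs.sub hρi) hd fun x => ?_
        calc _ = (2 * (g x - f x) - 1) * ρ x := by ring
          _ ≤ _ := mul_le_mul_of_nonneg_right (by nlinarith [sq_nonneg (g x - f x - 1)]) (hρ x)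
      rwa [integral_sub hs hρi, integral_const_mul, integral_sub hgi hfi,
        hρ1] at this
    nlinarith

end Hellinger

/-! ### Perturbed eigenvectors -/

section Spectrum

variable {k m : ℕ} {W W' : Matrix (Fin (k + m)) (Fin (k + m)) ℝ}

theorem norm_inactiveVar_le (hW : W ∈ Matrix.orthogonalGroup (Fin (k + m)) ℝ)
    (x : EuclideanSpace ℝ (Fin (k + m))) : ‖inactiveVar W x‖ ≤ ‖x‖ := by
  have h := norm_point_sq hW (activeVar W x) (inactiveVar W x)
  rw [point_activeVar_inactiveVar hW] at h
  exact (sq_le_sq₀ (norm_nonneg _) (norm_nonneg _)).1 (by nlinarith [sq_nonneg ‖activeVar W x‖])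

/-- The `l`-th column of a matrix, as a vector. -/
noncomputable def colVec {n : ℕ} (W : Matrix (Fin n) (Fin n) ℝ) (l : Fin n) :
    EuclideanSpace ℝ (Fin n) :=
  WithLp.toLp 2 fun i => W i l

theorem norm_colVec {n : ℕ} {W : Matrix (Fin n) (Fin n) ℝ}
    (hW : W ∈ Matrix.orthogonalGroup (Fin n) ℝ) (l : Fin n) : ‖colVec W l‖ = 1 := by
  have h := congrFun (congrFun ((Matrix.mem_orthogonalGroup_iff' (Fin n) ℝ).1 hW) l) l
  rw [Matrix.mul_apply, Matrix.one_apply_eq] at h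
  refine (sq_eq_sq₀ (norm_nonneg _) zero_le_one).1 ?_
  rw [EuclideanSpace.real_norm_sq_eq, one_pow, ← h]
  exact Finset.sum_congr rfl fun i _ => sq _

theorem inactiveVar_sub (W : Matrix (Fin (k + m)) (Fin (k + m)) ℝ)
    (x y : EuclideanSpace ℝ (Fin (k + m))) :
    inactiveVar W (x - y) = inactiveVar W x - inactiveVar W y := by
  apply WithLp.ofLp_injective
  simp [inactiveVar, Matrix.mulVec_sub]

theorem inactiveVar_apply (W : Matrix (Fin (k + m)) (Fin (k + m)) ℝ)
    (x : EuclideanSpace ℝ (Fin (k + m))) (j : Fin m) :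
    inactiveVar W x j = ∑ i, W i (Fin.natAdd k j) * x i := by
  simp [inactiveVar, inactiveCols, Matrix.mulVec, dotProduct]

theorem inactiveVar_colVec_castAdd (hW : W ∈ Matrix.orthogonalGroup (Fin (k + m)) ℝ) (l : Fin k) :
    inactiveVar W (colVec W (Fin.castAdd m l)) = 0 := by
  ext j
  have h := congrFun (congrFun ((Matrix.mem_orthogonalGroup_iff' (Fin (k + m)) ℝ).1 hW)
    (Fin.natAdd k j)) (Fin.castAdd m l)
  rw [Matrix.mul_apply, Matrix.one_apply_ne (by
    intro h
    have := congrArg Fin.val h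
    simp only [Fin.val_natAdd, Fin.val_castAdd] at this
    omega)] at h
  rw [inactiveVar_apply]
  exact h

theorem colVec_sub_norm_le {n : ℕ} {W W' : Matrix (Fin n) (Fin n) ℝ} {ε : ℝ}
    (hε : ‖Matrix.toEuclideanCLM (𝕜 := ℝ) (W - W')‖ ≤ ε) (l : Fin n) :
    ‖colVec W l - colVec W' l‖ ≤ ε := by
  have h : colVec W l - colVec W' l
      = Matrix.toEuclideanCLM (𝕜 := ℝ) (W - W') (EuclideanSpace.single l 1) := by
    apply WithLp.ofLp_injective
    rw [Matrix.ofLp_toEuclideanCLM]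
    ext i
    simp [colVec]
  rw [h]
  refine (ContinuousLinearMap.le_opNorm _ _).trans ?_
  simpa using hε

theorem sum_quadForm_eq {M : Matrix (Fin (k + m)) (Fin (k + m)) ℝ} {lam : Fin (k + m) → ℝ}
    (hM : M = W * Matrix.diagonal lam * Wᵀ) (a : Fin (k + m) → ℝ) :
    ∑ i, ∑ j, a i * a j * M i j = ∑ l, lam l * (∑ i, a i * W i l) ^ 2 := by
  have e : ∀ i j, M i j = ∑ l, W i l * lam l * W j l := by
    intro i j
    rw [hM, Matrix.mul_apply]
    simp [Matrix.mul_diagonal]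
  have e' : ∀ l, lam l * (∑ i, a i * W i l) ^ 2
      = ∑ i, ∑ j, a i * a j * (W i l * lam l * W j l) := by
    intro l
    rw [sq, Finset.sum_mul_sum, Finset.mul_sum]
    refine Finset.sum_congr rfl fun i _ => ?_
    rw [Finset.mul_sum]
    exact Finset.sum_congr rfl fun j _ => by ring
  simp only [e, e', Finset.mul_sum]
  rw [Finset.sum_congr rfl fun i _ => Finset.sum_comm, Finset.sum_comm]

end Spectrum

/-! ### Energy of the gradient in the inactive directions -/

section Gradient

variable {k m : ℕ} {W W' : Matrix (Fin (k + m)) (Fin (k + m)) ℝ} {lam : Fin (k + m) → ℝ}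
  {ρ f : EuclideanSpace ℝ (Fin (k + m)) → ℝ}

theorem ActiveSubspace.IsAdmissiblePrior.integral_sq_sum_gradOn (h : IsAdmissiblePrior ρ)
    (hfm : Measurable fun x : posSet ρ => f x) (hf : HasSqIntegrablePartials ρ f)
    (hM : gradOuterProduct ρ f = W * Matrix.diagonal lam * Wᵀ) (a : Fin (k + m) → ℝ) :
    Integrable (fun x => (∑ i, a i * gradOn ρ f x i) ^ 2 * ρ x) ∧
    ∫ x, (∑ i, a i * gradOn ρ f x i) ^ 2 * ρ x = ∑ l, lam l * (∑ i, a i * W i l) ^ 2 := by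
  have hi := integrable_gradOn_mul h.isOpen_posSet h.measurable h.nonneg hfm hf
  have e : ∀ x, (∑ i, a i * gradOn ρ f x i) ^ 2 * ρ x
      = ∑ i, ∑ j, a i * a j * (gradOn ρ f x i * gradOn ρ f x j * ρ x) := by
    intro x
    rw [sq, Finset.sum_mul_sum, Finset.sum_mul]
    refine Finset.sum_congr rfl fun i _ => ?_
    rw [Finset.sum_mul]
    exact Finset.sum_congr rfl fun j _ => by ring
  simp only [e]
  refine ⟨integrable_finsetSum _ fun i _ => integrable_finsetSum _ fun j _ =>
    (hi i j).const_mul _, ?_⟩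
  rw [integral_finsetSum _ fun i _ => integrable_finsetSum _ fun j _ => (hi i j).const_mul _,
    ← sum_quadForm_eq hM]
  refine Finset.sum_congr rfl fun i _ => ?_
  rw [integral_finsetSum _ fun j _ => (hi i j).const_mul _]
  refine Finset.sum_congr rfl fun j _ => ?_
  rw [integral_const_mul, gradOuterProduct_apply h.isOpen_posSet]

/-- Each eigenvalue is `∫ (w_l · ∇f)² ρ`, with `w_l` the `l`-th column of `W`. -/
theorem ActiveSubspace.IsAdmissiblePrior.eigenvalue_nonneg (h : IsAdmissiblePrior ρ)
    (hfm : Measurable fun x : posSet ρ => f x) (hf : HasSqIntegrablePartials ρ f)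
    (hM : gradOuterProduct ρ f = W * Matrix.diagonal lam * Wᵀ)
    (hW : W ∈ Matrix.orthogonalGroup (Fin (k + m)) ℝ) (l : Fin (k + m)) : 0 ≤ lam l := by
  have h1 := (h.integral_sq_sum_gradOn hfm hf hM fun i => W i l).2
  have h2 : ∀ l', ∑ i, W i l * W i l' = (1 : Matrix (Fin (k + m)) (Fin (k + m)) ℝ) l l' := by
    intro l'
    rw [← (Matrix.mem_orthogonalGroup_iff' (Fin (k + m)) ℝ).1 hW, Matrix.mul_apply]
    rfl
  simp only [h2, Matrix.one_apply] at h1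
  simp only [ite_pow, one_pow, ne_eq, OfNat.ofNat_ne_zero, not_false_eq_true, zero_pow, mul_ite,
    mul_one, mul_zero, Finset.sum_ite_eq, Finset.mem_univ, if_true] at h1
  rw [← h1]
  exact integral_nonneg fun x => mul_nonneg (sq_nonneg _) (h.nonneg x)

/-- Diagonalization turns the energy into `∑ λ_l ‖W'₂ᵀ w_l‖²`. For an active index `W'₂ᵀ` kills the
corresponding column of `W'`, so only the difference of the two columns, of norm at most `ε`,
contributes. For an inactive index the norm is at most `1`. -/
theorem ActiveSubspace.IsAdmissiblePrior.lintegral_norm_inactiveVar_gradOn_le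
    (h : IsAdmissiblePrior ρ)
    (hfm : Measurable fun x : posSet ρ => f x) (hf : HasSqIntegrablePartials ρ f)
    (hM : gradOuterProduct ρ f = W * Matrix.diagonal lam * Wᵀ)
    (hW : W ∈ Matrix.orthogonalGroup (Fin (k + m)) ℝ)
    (hW' : W' ∈ Matrix.orthogonalGroup (Fin (k + m)) ℝ) {ε : ℝ}
    (hε : ‖Matrix.toEuclideanCLM (𝕜 := ℝ) (W - W')‖ ≤ ε) :
    ∫⁻ x, ENNReal.ofReal (ρ x) * ENNReal.ofReal (‖inactiveVar W' (gradOn ρ f x)‖ ^ 2)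
      ≤ ENNReal.ofReal (ε ^ 2 * (∑ i : Fin k, lam (Fin.castAdd m i))
        + ∑ i : Fin m, lam (Fin.natAdd k i)) := by
  have hlam := h.eigenvalue_nonneg hfm hf hM hW
  have hε0 : 0 ≤ ε := (norm_nonneg _).trans hε
  have key := fun j : Fin m => h.integral_sq_sum_gradOn hfm hf hM fun i => W' i (Fin.natAdd k j)
  have e : ∀ x, ρ x * ‖inactiveVar W' (gradOn ρ f x)‖ ^ 2
      = ∑ j : Fin m, (∑ i, W' i (Fin.natAdd k j) * gradOn ρ f x i) ^ 2 * ρ x := by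
    intro x
    rw [EuclideanSpace.real_norm_sq_eq, mul_comm, Finset.sum_mul]
    simp only [inactiveVar_apply]
  have hi : Integrable fun x => ρ x * ‖inactiveVar W' (gradOn ρ f x)‖ ^ 2 := by
    simp only [e]
    exact integrable_finsetSum _ fun j _ => (key j).1
  simp only [← ENNReal.ofReal_mul (h.nonneg _)]
  rw [← ofReal_integral_eq_lintegral_ofReal hi
    (Eventually.of_forall fun x => mul_nonneg (h.nonneg x) (sq_nonneg _))]
  refine ENNReal.ofReal_le_ofReal ?_
  simp only [e]
  rw [integral_finsetSum _ fun j _ => (key j).1, Finset.sum_congr rfl fun j _ => (key j).2,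
    Finset.sum_comm]
  have e2 : ∀ l, ∑ j : Fin m, lam l * (∑ i, W' i (Fin.natAdd k j) * W i l) ^ 2
      = lam l * ‖inactiveVar W' (colVec W l)‖ ^ 2 := by
    intro l
    rw [← Finset.mul_sum, EuclideanSpace.real_norm_sq_eq]
    simp only [inactiveVar_apply, colVec]
  simp only [e2]
  rw [Fin.sum_univ_add, Finset.mul_sum]
  refine add_le_add (Finset.sum_le_sum fun i _ => ?_) (Finset.sum_le_sum fun i _ => ?_)
  · rw [mul_comm]
    refine mul_le_mul_of_nonneg_right ?_ (hlam _)
    refine pow_le_pow_left₀ (norm_nonneg _) ?_ 2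
    have h1 : inactiveVar W' (colVec W (Fin.castAdd m i))
        = inactiveVar W' (colVec W (Fin.castAdd m i) - colVec W' (Fin.castAdd m i)) := by
      rw [inactiveVar_sub, inactiveVar_colVec_castAdd hW', sub_zero]
    rw [h1]
    exact (norm_inactiveVar_le hW' _).trans (colVec_sub_norm_le hε _)
  · refine mul_le_of_le_one_right (hlam _) (pow_le_one₀ (norm_nonneg _) ?_)
    exact (norm_inactiveVar_le hW' _).trans (norm_colVec hW _).le

end Gradient

/-! ### Mean squared error of the Monte Carlo approximation -/

section MonteCarlo

variable {k m N : ℕ} {Ω : Type*}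
  {ρ : EuclideanSpace ℝ (Fin (k + m)) → ℝ} {W : Matrix (Fin (k + m)) (Fin (k + m)) ℝ}
  {Z : Fin N → EuclideanSpace ℝ (Fin k) → Ω → EuclideanSpace ℝ (Fin m)}
  {f F : EuclideanSpace ℝ (Fin (k + m)) → ℝ}

/-- The samples, extended by zero outside the active domain. -/
noncomputable def extendedSample (ρ : EuclideanSpace ℝ (Fin (k + m)) → ℝ)
    (W : Matrix (Fin (k + m)) (Fin (k + m)) ℝ)
    (Z : Fin N → EuclideanSpace ℝ (Fin k) → Ω → EuclideanSpace ℝ (Fin m)) (j : Fin N)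
    (p : EuclideanSpace ℝ (Fin k) × Ω) : EuclideanSpace ℝ (Fin m) :=
  (activeDomain ρ W ×ˢ Set.univ).indicator (fun p => Z j p.1 p.2) p

theorem extendedSample_of_mem {y : EuclideanSpace ℝ (Fin k)} (hy : y ∈ activeDomain ρ W)
    (j : Fin N) (ω : Ω) : extendedSample ρ W Z j (y, ω) = Z j y ω :=
  Set.indicator_of_mem (s := activeDomain ρ W ×ˢ Set.univ) (a := (y, ω)) ⟨hy, trivial⟩ _

/-- The points at which the Monte Carlo approximation evaluates the function. -/
noncomputable def samplePoint (ρ : EuclideanSpace ℝ (Fin (k + m)) → ℝ)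
    (W : Matrix (Fin (k + m)) (Fin (k + m)) ℝ)
    (Z : Fin N → EuclideanSpace ℝ (Fin k) → Ω → EuclideanSpace ℝ (Fin m)) (j : Fin N)
    (p : EuclideanSpace ℝ (Fin (k + m)) × Ω) : EuclideanSpace ℝ (Fin (k + m)) :=
  point W (activeVar W p.1) (extendedSample ρ W Z j (activeVar W p.1, p.2))

theorem samplePoint_of_mem {x : EuclideanSpace ℝ (Fin (k + m))} (hx : x ∈ posSet ρ) (j : Fin N)
    (ω : Ω) : samplePoint ρ W Z j (x, ω) = point W (activeVar W x) (Z j (activeVar W x) ω) := by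
  rw [samplePoint, extendedSample_of_mem (Set.mem_image_of_mem _ hx)]

/-- The average of `F` over the sample points. -/
noncomputable def sampleMean (ρ : EuclideanSpace ℝ (Fin (k + m)) → ℝ)
    (W : Matrix (Fin (k + m)) (Fin (k + m)) ℝ)
    (Z : Fin N → EuclideanSpace ℝ (Fin k) → Ω → EuclideanSpace ℝ (Fin m))
    (F : EuclideanSpace ℝ (Fin (k + m)) → ℝ) (ω : Ω) (x : EuclideanSpace ℝ (Fin (k + m))) : ℝ :=
  (N : ℝ)⁻¹ * ∑ j : Fin N, F (samplePoint ρ W Z j (x, ω))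

theorem sq_sub_sampleMean_le (hN : 0 < N) (ω : Ω) (x : EuclideanSpace ℝ (Fin (k + m))) :
    (F x - sampleMean ρ W Z F ω x) ^ 2
      ≤ (N : ℝ)⁻¹ * ∑ j : Fin N, (F (samplePoint ρ W Z j (x, ω)) - F x) ^ 2 := by
  have hN' : (0 : ℝ) < N := by exact_mod_cast hN
  have h1 := sq_sum_le_card_mul_sum_sq (s := Finset.univ)
    (f := fun j : Fin N => F (samplePoint ρ W Z j (x, ω)) - F x)
  have h2 : F x - sampleMean ρ W Z F ω x
      = -((N : ℝ)⁻¹ * ∑ j : Fin N, (F (samplePoint ρ W Z j (x, ω)) - F x)) := by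
    rw [sampleMean, Finset.sum_sub_distrib, Finset.sum_const, Finset.card_univ, Fintype.card_fin,
      nsmul_eq_mul]
    field_simp
    ring
  rw [h2, neg_sq, mul_pow]
  rw [Finset.card_univ, Fintype.card_fin] at h1
  calc _ ≤ ((N : ℝ)⁻¹) ^ 2 * (N * ∑ j : Fin N, (F (samplePoint ρ W Z j (x, ω)) - F x) ^ 2) := by
        gcongr
    _ = _ := by field_simp

/-- In rotated coordinates the active domain is the image of an open set under a product projection.
Its measurability allows the samples to be extended by zero. -/
theorem isOpen_activeDomain (hΩ : IsOpen (posSet ρ))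
    (hW : W ∈ Matrix.orthogonalGroup (Fin (k + m)) ℝ) : IsOpen (activeDomain ρ W) := by
  have : activeDomain ρ W = Prod.fst ''
      ((fun p : EuclideanSpace ℝ (Fin k) × EuclideanSpace ℝ (Fin m) => point W p.1 p.2) ⁻¹'
        posSet ρ) := by
    ext y
    constructor
    · rintro ⟨x, hx, rfl⟩
      refine ⟨(activeVar W x, inactiveVar W x), ?_, rfl⟩
      change point W (activeVar W x) (inactiveVar W x) ∈ posSet ρ
      rwa [point_activeVar_inactiveVar hW]
    · rintro ⟨p, hp, rfl⟩
      exact ⟨_, hp, activeVar_point hW _ _⟩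
  rw [this]
  exact isOpenMap_fst _ (hΩ.preimage (continuous_point W))

variable [MeasurableSpace Ω] {P : Measure Ω}

theorem measurable_extendedSample (hΩ : IsOpen (posSet ρ))
    (hW : W ∈ Matrix.orthogonalGroup (Fin (k + m)) ℝ) (hS : IsConditionalSample P ρ W Z)
    (j : Fin N) : Measurable (extendedSample ρ W Z j) := by
  have hs : MeasurableSet (activeDomain ρ W ×ˢ (Set.univ : Set Ω)) :=
    (isOpen_activeDomain hΩ hW).measurableSet.prod MeasurableSet.univ
  refine measurable_of_restrict_of_restrict_compl hs ?_ ?_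
  · have h1 : Measurable fun p : (activeDomain ρ W ×ˢ (Set.univ : Set Ω) :
        Set (EuclideanSpace ℝ (Fin k) × Ω)) => ((⟨p.1.1, p.2.1⟩ : activeDomain ρ W), p.1.2) := by
      fun_prop
    convert (hS.measurable j).comp h1 using 1
    ext1 p
    exact extendedSample_of_mem p.2.1 j p.1.2
  · convert (measurable_const : Measurable fun _ : ((activeDomain ρ W ×ˢ (Set.univ : Set Ω))ᶜ :
        Set (EuclideanSpace ℝ (Fin k) × Ω)) => (0 : EuclideanSpace ℝ (Fin m))) using 1
    ext1 p
    exact Set.indicator_of_notMem (s := activeDomain ρ W ×ˢ (Set.univ : Set Ω)) p.2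
      (fun p => Z j p.1 p.2)

theorem measurable_samplePoint (hΩ : IsOpen (posSet ρ))
    (hW : W ∈ Matrix.orthogonalGroup (Fin (k + m)) ℝ) (hS : IsConditionalSample P ρ W Z)
    (j : Fin N) : Measurable (samplePoint ρ W Z j) := by
  have h := measurable_extendedSample hΩ hW hS j
  have h1 := (continuous_activeVar W).measurable
  exact measurable_point_comp (by fun_prop) (h.comp (by fun_prop))

theorem IsConditionalSample.measurable_section (hS : IsConditionalSample P ρ W Z)
    {y : EuclideanSpace ℝ (Fin k)} (hy : y ∈ activeDomain ρ W) (j : Fin N) :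
    Measurable (Z j y) :=
  (hS.measurable j).comp (measurable_prodMk_left (x := (⟨y, hy⟩ : activeDomain ρ W)))

theorem measurable_point_right (W : Matrix (Fin (k + m)) (Fin (k + m)) ℝ)
    (y : EuclideanSpace ℝ (Fin k)) :
    Measurable fun z : EuclideanSpace ℝ (Fin m) => point W y z :=
  measurable_point_comp measurable_const measurable_id

theorem ae_condLaw_mem_posSet (hρm : Measurable ρ) (hρ : ∀ x, 0 ≤ ρ x)
    (y : EuclideanSpace ℝ (Fin k)) : ∀ᵐ z ∂condLaw ρ W y, point W y z ∈ posSet ρ := by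
  have hpt := measurable_point_right W y
  have hcond : Measurable (condDensity ρ W y) := by
    unfold condDensity
    fun_prop
  rw [condLaw, ae_withDensity_iff hcond.ennreal_ofReal]
  refine Eventually.of_forall fun z hz => lt_of_le_of_ne (hρ _) fun h => hz ?_
  rw [condDensity, ← h, zero_div, ENNReal.ofReal_zero]

/-- For fixed `x` the conditional law charges only points with `ρ > 0`. Fubini turns this into a
statement about almost every `ω`. -/
theorem ae_samplePoint_mem_posSet [SFinite P] (hΩ : IsOpen (posSet ρ)) (hρm : Measurable ρ)
    (hρ : ∀ x, 0 ≤ ρ x)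
    (hW : W ∈ Matrix.orthogonalGroup (Fin (k + m)) ℝ) (hS : IsConditionalSample P ρ W Z) :
    ∀ᵐ ω ∂P, ∀ᵐ x, x ∈ posSet ρ → ∀ j, samplePoint ρ W Z j (x, ω) ∈ posSet ρ := by
  refine (Measure.ae_ae_comm (μ := volume) (ν := P)
    (p := fun x ω => x ∈ posSet ρ → ∀ j, samplePoint ρ W Z j (x, ω) ∈ posSet ρ) ?_).1
    (Eventually.of_forall fun x => ?_)
  · have h1 : MeasurableSet {p : EuclideanSpace ℝ (Fin (k + m)) × Ω | p.1 ∈ posSet ρ} :=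
      measurable_fst hΩ.measurableSet
    have h2 : MeasurableSet {p : EuclideanSpace ℝ (Fin (k + m)) × Ω |
        ∀ j, samplePoint ρ W Z j (p.1, p.2) ∈ posSet ρ} := by
      rw [Set.ofPred_forall]
      exact MeasurableSet.iInter fun j => measurable_samplePoint hΩ hW hS j hΩ.measurableSet
    exact h1.imp h2
  · by_cases hx : x ∈ posSet ρ
    swap
    · exact Eventually.of_forall fun ω h => absurd h hx
    have hy : activeVar W x ∈ activeDomain ρ W := Set.mem_image_of_mem _ hx
    have h1 : ∀ j, ∀ᵐ ω ∂P, point W (activeVar W x) (Z j (activeVar W x) ω) ∈ posSet ρ := by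
      intro j
      refine ae_of_ae_map (IsConditionalSample.measurable_section hS hy j).aemeasurable
        (p := fun z => point W (activeVar W x) z ∈ posSet ρ) ?_
      rw [hS.law _ hy j]
      exact ae_condLaw_mem_posSet hρm hρ _
    filter_upwards [ae_all_iff.2 h1] with ω hω _ j
    rw [samplePoint_of_mem hx]
    exact hω j

theorem measurable_sampleMean (hΩ : IsOpen (posSet ρ))
    (hW : W ∈ Matrix.orthogonalGroup (Fin (k + m)) ℝ) (hS : IsConditionalSample P ρ W Z)
    (hF : Measurable F) :
    Measurable fun p : Ω × EuclideanSpace ℝ (Fin (k + m)) => sampleMean ρ W Z F p.1 p.2 := by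
  have h := fun j => (measurable_samplePoint hΩ hW hS j)
  unfold sampleMean
  fun_prop

/-- Neither `f` off `{ρ > 0}` nor the samples off the active domain are controlled. This permits
replacing them by their zero extensions, which are measurable. -/
theorem ae_posterior_monteCarloApprox_eq [SFinite P] (hΩ : IsOpen (posSet ρ)) (hρm : Measurable ρ)
    (hρ : ∀ x, 0 ≤ ρ x)
    (hW : W ∈ Matrix.orthogonalGroup (Fin (k + m)) ℝ) (hS : IsConditionalSample P ρ W Z) :
    ∀ᵐ ω ∂P, ActiveSubspace.posterior ρ (monteCarloApprox f W Z ω) =ᵐ[volume]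
      ActiveSubspace.posterior ρ (sampleMean ρ W Z ((posSet ρ).indicator f) ω) := by
  filter_upwards [ae_samplePoint_mem_posSet hΩ hρm hρ hW hS] with ω hω
  have h1 : (fun x => Real.exp (-monteCarloApprox f W Z ω x) * ρ x) =ᵐ[volume]
      fun x => Real.exp (-sampleMean ρ W Z ((posSet ρ).indicator f) ω x) * ρ x := by
    filter_upwards [hω] with x hx
    by_cases hxρ : x ∈ posSet ρ
    · congr 3
      rw [monteCarloApprox, sampleMean]
      congr 1
      refine Finset.sum_congr rfl fun j _ => ?_
      rw [Set.indicator_of_mem (hx hxρ j), samplePoint_of_mem hxρ]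
    · rw [le_antisymm (not_lt.1 hxρ) (hρ x), mul_zero, mul_zero]
  have h2 : normConst ρ (monteCarloApprox f W Z ω)
      = normConst ρ (sampleMean ρ W Z ((posSet ρ).indicator f) ω) := integral_congr_ae h1
  filter_upwards [h1] with x hx
  rw [ActiveSubspace.posterior, ActiveSubspace.posterior, hx, h2]

/-- After Cauchy–Schwarz over the samples, Tonelli puts the expectation inside. For fixed `x` each
sample has the conditional law at the active variable of `x`, so all `N` terms have the same
integral. -/
theorem lintegral_sampleMean_le [SFinite P] (hN : 0 < N) (hΩ : IsOpen (posSet ρ))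
    (hρm : Measurable ρ) (hρ : ∀ x, 0 ≤ ρ x)
    (hW : W ∈ Matrix.orthogonalGroup (Fin (k + m)) ℝ) (hS : IsConditionalSample P ρ W Z)
    (hF : Measurable F) :
    ∫⁻ ω, (∫⁻ x, ENNReal.ofReal ((F x - sampleMean ρ W Z F ω x) ^ 2 * ρ x)) ∂P
      ≤ ∫⁻ y, ∫⁻ z, ENNReal.ofReal (ρ (point W y z)) *
        ∫⁻ z', ENNReal.ofReal ((F (point W y z') - F (point W y z)) ^ 2) ∂condLaw ρ W y := by
  have hN' : (0 : ℝ) < N := by exact_mod_cast hN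
  have hsp := fun j => measurable_samplePoint hΩ hW hS j
  set A : Fin N → EuclideanSpace ℝ (Fin (k + m)) × Ω → ENNReal := fun j p =>
    ENNReal.ofReal (ρ p.1) * ENNReal.ofReal ((F (samplePoint ρ W Z j p) - F p.1) ^ 2) with hA
  have hAm : ∀ j, Measurable (A j) := fun j => by have := hsp j; fun_prop
  set J := ∫⁻ y, ∫⁻ z, ENNReal.ofReal (ρ (point W y z)) *
        ∫⁻ z', ENNReal.ofReal ((F (point W y z') - F (point W y z)) ^ 2) ∂condLaw ρ W y
  have hAJ : ∀ j, ∫⁻ x, ∫⁻ ω, A j (x, ω) ∂P = J := by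
    intro j
    rw [lintegral_point hW (hAm j).lintegral_prod_right']
    refine lintegral_congr fun y => lintegral_congr fun z => ?_
    by_cases hx : point W y z ∈ posSet ρ
    · have hy : y ∈ activeDomain ρ W := ⟨_, hx, activeVar_point hW y z⟩
      have hpt := measurable_point_right W y
      simp only [hA, samplePoint_of_mem hx, activeVar_point hW]
      have hZ := IsConditionalSample.measurable_section hS hy j
      rw [lintegral_const_mul _ (by fun_prop), ← hS.law y hy j,
        lintegral_map (by fun_prop) hZ]
    · have h0 : ENNReal.ofReal (ρ (point W y z)) = 0 :=
        ENNReal.ofReal_eq_zero.2 (not_lt.1 hx)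
      simp [hA, h0]
  have hpt : ∀ ω x, ENNReal.ofReal ((F x - sampleMean ρ W Z F ω x) ^ 2 * ρ x)
      ≤ ENNReal.ofReal (N : ℝ)⁻¹ * ∑ j, A j (x, ω) := by
    intro ω x
    simp only [hA]
    rw [← Finset.mul_sum, ← ENNReal.ofReal_sum_of_nonneg fun j _ => sq_nonneg _,
      ← ENNReal.ofReal_mul (hρ x), ← ENNReal.ofReal_mul (by positivity)]
    refine ENNReal.ofReal_le_ofReal ?_
    calc _ ≤ ((N : ℝ)⁻¹ * ∑ j : Fin N, (F (samplePoint ρ W Z j (x, ω)) - F x) ^ 2) * ρ x :=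
          mul_le_mul_of_nonneg_right (sq_sub_sampleMean_le hN ω x) (hρ x)
      _ = _ := by ring
  calc ∫⁻ ω, (∫⁻ x, ENNReal.ofReal ((F x - sampleMean ρ W Z F ω x) ^ 2 * ρ x)) ∂P
      ≤ ∫⁻ ω, (∫⁻ x, ENNReal.ofReal (N : ℝ)⁻¹ * ∑ j, A j (x, ω)) ∂P :=
        lintegral_mono fun ω => lintegral_mono fun x => hpt ω x
    _ = ∫⁻ x, ∫⁻ ω, ENNReal.ofReal (N : ℝ)⁻¹ * ∑ j, A j (x, ω) ∂P :=
        (lintegral_lintegral_swap (by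
          have : Measurable fun p : EuclideanSpace ℝ (Fin (k + m)) × Ω =>
            ENNReal.ofReal (N : ℝ)⁻¹ * ∑ j, A j p := by fun_prop
          exact this.aemeasurable)).symm
    _ = ENNReal.ofReal (N : ℝ)⁻¹ * ∑ j : Fin N, ∫⁻ x, ∫⁻ ω, A j (x, ω) ∂P := by
        have e : ∀ x, ∫⁻ ω, ENNReal.ofReal (N : ℝ)⁻¹ * ∑ j, A j (x, ω) ∂P
            = ENNReal.ofReal (N : ℝ)⁻¹ * ∑ j, ∫⁻ ω, A j (x, ω) ∂P := by
          intro x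
          rw [lintegral_const_mul _ (by fun_prop), lintegral_finsetSum _ (by fun_prop)]
        simp only [e]
        have e2 : ∀ j, Measurable fun x => ∫⁻ ω, A j (x, ω) ∂P :=
          fun j => (hAm j).lintegral_prod_right'
        rw [lintegral_const_mul _ (by fun_prop), lintegral_finsetSum _ (by fun_prop)]
    _ = J := by
        simp only [hAJ, Finset.sum_const, Finset.card_univ, Fintype.card_fin, nsmul_eq_mul]
        rw [← mul_assoc, ← ENNReal.ofReal_natCast N, ← ENNReal.ofReal_mul (by positivity),
          inv_mul_cancel₀ hN'.ne', ENNReal.ofReal_one, one_mul]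
    _ ≤ J := le_rfl

end MonteCarlo

/-! ### Expected Hellinger distance -/

section Expectation

theorem measurable_hellingerDist_posterior {n : ℕ} {Ω : Type*} [MeasurableSpace Ω]
    {ρ f : EuclideanSpace ℝ (Fin n) → ℝ} (hρ : Measurable ρ) (hf : Measurable f)
    {g : Ω → EuclideanSpace ℝ (Fin n) → ℝ}
    (hg : Measurable fun p : Ω × EuclideanSpace ℝ (Fin n) => g p.1 p.2) :
    Measurable fun ω => hellingerDist (ActiveSubspace.posterior ρ f)
      (ActiveSubspace.posterior ρ (g ω)) := by
  have h1 : Measurable fun ω => normConst ρ (g ω) := by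
    have : Measurable fun p : Ω × EuclideanSpace ℝ (Fin n) => Real.exp (-g p.1 p.2) * ρ p.2 := by
      fun_prop
    exact (this.stronglyMeasurable.integral_prod_right' (ν := volume)).measurable
  have h2 : Measurable (ActiveSubspace.posterior ρ f) := by
    unfold ActiveSubspace.posterior
    fun_prop
  have h2' : Measurable fun p : Ω × EuclideanSpace ℝ (Fin n) =>
      ActiveSubspace.posterior ρ (g p.1) p.2 :=
    ((Real.measurable_exp.comp hg.neg).mul (hρ.comp measurable_snd)).div (h1.comp measurable_fst)
  have h3 := ((h2.comp measurable_snd).sqrt.sub h2'.sqrt).pow_const 2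
  have h4 := (h3.stronglyMeasurable.integral_prod_right' (ν := volume)).measurable
  unfold hellingerDist
  fun_prop

theorem integrable_and_integral_le_of_le_sqrt {Ω : Type*} [MeasurableSpace Ω] {P : Measure Ω}
    [IsProbabilityMeasure P] {X Y : Ω → ℝ} {c J : ℝ} (hc : 0 ≤ c) (hX : AEStronglyMeasurable X P)
    (hX0 : ∀ ω, 0 ≤ X ω) (hY : Integrable Y P) (hY0 : ∀ ω, 0 ≤ Y ω) (hXY : ∀ᵐ ω ∂P, X ω ≤ c * √(Y ω))
    (hJ : ∫ ω, Y ω ∂P ≤ J) :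
    Integrable X P ∧ ∫ ω, X ω ∂P ≤ c * √J := by
  have hsq : Integrable (fun ω => √(Y ω)) P := by
    refine (hY.add (integrable_const 1)).mono' (hY.aestronglyMeasurable.aemeasurable.sqrt
      |>.aestronglyMeasurable) (Eventually.of_forall fun ω => ?_)
    rw [Real.norm_of_nonneg (Real.sqrt_nonneg _), Pi.add_apply]
    nlinarith [Real.sq_sqrt (hY0 ω), sq_nonneg (√(Y ω) - 1), Real.sqrt_nonneg (Y ω)]
  have hXi : Integrable X P := by
    refine (hsq.const_mul c).mono' hX ?_
    filter_upwards [hXY] with ω hω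
    rwa [Real.norm_of_nonneg (hX0 ω)]
  refine ⟨hXi, ?_⟩
  have hjensen : ∫ ω, √(Y ω) ∂P ≤ √(∫ ω, Y ω ∂P) :=
    Real.strictConcaveOn_sqrt.concaveOn.le_map_integral Real.continuous_sqrt.continuousOn
      isClosed_Ici (Eventually.of_forall hY0) hY hsq
  calc ∫ ω, X ω ∂P ≤ ∫ ω, c * √(Y ω) ∂P := integral_mono_ae hXi (hsq.const_mul c) hXY
    _ = c * ∫ ω, √(Y ω) ∂P := integral_const_mul _ _
    _ ≤ c * √J := by
        gcongr
        exact hjensen.trans (Real.sqrt_le_sqrt hJ)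

end Expectation

theorem dataMisfit_nonneg {n q : ℕ} {Γ : Matrix (Fin q) (Fin q) ℝ} (hΓ : Γ.PosDef)
    (d : Fin q → ℝ) (G : EuclideanSpace ℝ (Fin n) → Fin q → ℝ) (x : EuclideanSpace ℝ (Fin n)) :
    0 ≤ dataMisfit Γ d G x := by
  have := hΓ.inv.posSemidef.dotProduct_mulVec_nonneg (d - G x)
  rw [star_trivial] at this
  exact mul_nonneg (by norm_num) this

theorem hellingerConst_nonneg {n : ℕ} (ρ f : EuclideanSpace ℝ (Fin n) → ℝ) :
    0 ≤ hellingerConst ρ f := Real.sqrt_nonneg _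

/-- A finite mean squared error makes the error finite for almost every `ω`, so the stability bound
applies almost surely. Jensen for the square root then gives the expectation. -/
theorem ActiveSubspace.IsAdmissiblePrior.integral_hellingerDist_posterior_le {n : ℕ} {Ω : Type*}
    [MeasurableSpace Ω] {P : Measure Ω} [IsProbabilityMeasure P]
    {ρ F : EuclideanSpace ℝ (Fin n) → ℝ} (hρ : IsAdmissiblePrior ρ) (hF : Measurable F)
    (hF0 : ∀ x, 0 ≤ F x) (hFρ : Integrable fun x => F x * ρ x)
    {g : Ω → EuclideanSpace ℝ (Fin n) → ℝ}
    (hg : Measurable fun p : Ω × EuclideanSpace ℝ (Fin n) => g p.1 p.2) (hg0 : ∀ ω x, 0 ≤ g ω x)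
    {J : ℝ} (hJ0 : 0 ≤ J)
    (hmean : ∫⁻ ω, (∫⁻ x, ENNReal.ofReal ((F x - g ω x) ^ 2 * ρ x)) ∂P ≤ ENNReal.ofReal J) :
    Integrable (fun ω => hellingerDist (ActiveSubspace.posterior ρ F)
      (ActiveSubspace.posterior ρ (g ω))) P ∧
    ∫ ω, hellingerDist (ActiveSubspace.posterior ρ F) (ActiveSubspace.posterior ρ (g ω)) ∂P
      ≤ √8 * hellingerConst ρ F * √J := by
  have hρm := hρ.measurable
  have hL := hellingerConst_nonneg ρ F
  have hsqm : Measurable fun p : Ω × EuclideanSpace ℝ (Fin n) =>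
      (F p.2 - g p.1 p.2) ^ 2 * ρ p.2 := by fun_prop
  have hYm : Measurable fun ω => ∫⁻ x, ENNReal.ofReal ((F x - g ω x) ^ 2 * ρ x) :=
    hsqm.ennreal_ofReal.lintegral_prod_right'
  set Y : Ω → ℝ := fun ω => (∫⁻ x, ENNReal.ofReal ((F x - g ω x) ^ 2 * ρ x)).toReal with hY
  have hfin := ne_top_of_le_ne_top ENNReal.ofReal_ne_top hmean
  have hYi : Integrable Y P := integrable_toReal_of_lintegral_ne_top hYm.aemeasurable hfin
  have hYJ : ∫ ω, Y ω ∂P ≤ J := by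
    rw [hY, integral_toReal hYm.aemeasurable (ae_lt_top hYm hfin)]
    exact ENNReal.toReal_le_of_le_ofReal hJ0 hmean
  have hbound : ∀ᵐ ω ∂P, hellingerDist (ActiveSubspace.posterior ρ F)
      (ActiveSubspace.posterior ρ (g ω)) ≤ √8 * hellingerConst ρ F * √(Y ω) := by
    filter_upwards [ae_lt_top hYm hfin] with ω hω
    have hgω : Measurable (g ω) := hg.comp measurable_prodMk_left
    have hnn : ∀ x, 0 ≤ (F x - g ω x) ^ 2 * ρ x := fun x =>
      mul_nonneg (sq_nonneg _) (hρ.nonneg x)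
    have hd : Integrable fun x => (F x - g ω x) ^ 2 * ρ x :=
      (lintegral_ofReal_ne_top_iff_integrable (by fun_prop) (Eventually.of_forall hnn)).1 hω.ne
    refine (hellingerDist_posterior_le hρm hρ.nonneg hρ.integrable hρ.integral_eq_one hF hF0 hFρ
      hgω (hg0 ω) hd).trans (le_of_eq ?_)
    rw [hY, integral_eq_lintegral_of_nonneg_ae (Eventually.of_forall hnn) (by fun_prop)]
  exact integrable_and_integral_le_of_le_sqrt (P := P) (by positivity)
    (measurable_hellingerDist_posterior hρm hF hg).aestronglyMeasurable
    (fun ω => Real.sqrt_nonneg _) hYi (fun ω => ENNReal.toReal_nonneg) hbound hYJ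

/-! ### Assembling the bound -/

theorem mainTheorem5 {k m : ℕ} (hk : 0 < k) (hm : 0 < m)
    (ρ : EuclideanSpace ℝ (Fin (k + m)) → ℝ) (hρ : IsAdmissiblePrior ρ) :
    ∃ C : ℝ, 0 < C ∧
      ∀ (q : ℕ) (Γ : Matrix (Fin q) (Fin q) ℝ) (d : Fin q → ℝ)
        (G : EuclideanSpace ℝ (Fin (k + m)) → Fin q → ℝ)
        (f : EuclideanSpace ℝ (Fin (k + m)) → ℝ)
        (W W' : Matrix (Fin (k + m)) (Fin (k + m)) ℝ) (lam : Fin (k + m) → ℝ) (ε : ℝ)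
        (N : ℕ) (Ω : Type*) [MeasurableSpace Ω] (P : Measure Ω) [IsProbabilityMeasure P]
        (Z : Fin N → EuclideanSpace ℝ (Fin k) → Ω → EuclideanSpace ℝ (Fin m)),
        Γ.PosDef →
        f = dataMisfit Γ d G →
        (Measurable fun x : posSet ρ => f x) →
        HasSqIntegrablePartials ρ f →
        W ∈ Matrix.orthogonalGroup (Fin (k + m)) ℝ →
        Antitone lam →
        gradOuterProduct ρ f = W * Matrix.diagonal lam * Wᵀ →
        W' ∈ Matrix.orthogonalGroup (Fin (k + m)) ℝ →
        0 < ε →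
        ‖Matrix.toEuclideanCLM (𝕜 := ℝ) (W - W')‖ ≤ ε →
        0 < N →
        IsConditionalSample P ρ W' Z →
        IntegrableOn (fun x => f x * ρ x) (posSet ρ) ∧
        Integrable (fun ω =>
          hellingerDist (posterior ρ f) (posterior ρ (monteCarloApprox f W' Z ω))) P ∧
        ∫ ω, hellingerDist (posterior ρ f) (posterior ρ (monteCarloApprox f W' Z ω)) ∂P ≤
          √C * hellingerConst ρ f * (1 + (N : ℝ) ^ (-(1 / 2) : ℝ)) *
            (ε * √(∑ i : Fin k, lam (Fin.castAdd m i)) +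
              √(∑ i : Fin m, lam (Fin.natAdd k i))) := by
  obtain ⟨K, hK, hB⟩ := hρ.exists_bridgeBound_slices
  set c : ℝ := (pathConst ^ 2 * K).toReal with hcdef
  have hcK : pathConst ^ 2 * K = ENNReal.ofReal c :=
    (ENNReal.ofReal_toReal (ENNReal.mul_ne_top (ENNReal.pow_ne_top pathConst_ne_top) hK)).symm
  have hc0 : 0 ≤ c := ENNReal.toReal_nonneg
  -- The `8` cancels the `1/8` inside `hellingerConst`; the `+ 1` only ensures positivity.
  refine ⟨8 * c + 1, by positivity, ?_⟩
  intro q Γ d G f W W' lam ε N Ω _ P _ Z hΓ hfG hfm hf hW _ hM hW' _ hWW' hN hS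
  have hf0 : ∀ x, 0 ≤ f x := fun x => hfG ▸ dataMisfit_nonneg hΓ d G x
  have hΩ := hρ.isOpen_posSet
  have hρm := hρ.measurable
  set F := (posSet ρ).indicator f with hFdef
  have hF : Measurable F := measurable_indicator_of_subtype hΩ.measurableSet hfm
  have hF0 : ∀ x, 0 ≤ F x := Set.indicator_nonneg fun x _ => hf0 x
  have hFρ : Integrable fun x => F x * ρ x := hρ.integrable_mul hf0 hfm hf
  have hFf : ∀ x, Real.exp (-f x) * ρ x = Real.exp (-F x) * ρ x := by
    intro x
    by_cases hx : x ∈ posSet ρ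
    · rw [hFdef, Set.indicator_of_mem hx]
    · rw [le_antisymm (not_lt.1 hx) (hρ.nonneg x), mul_zero, mul_zero]
  have hfF : ∀ x ∈ posSet ρ, F x * ρ x = f x * ρ x := fun x hx => by
    rw [hFdef, Set.indicator_of_mem hx]
  have hnorm : normConst ρ f = normConst ρ F := by simp only [normConst, hFf]
  have hpost : ActiveSubspace.posterior ρ f = ActiveSubspace.posterior ρ F := by
    ext x
    rw [ActiveSubspace.posterior, ActiveSubspace.posterior, hFf, hnorm]
  have hconst : hellingerConst ρ f = hellingerConst ρ F := by
    rw [hellingerConst, hellingerConst, hnorm, setIntegral_congr_fun hΩ.measurableSet hfF]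
  refine ⟨hFρ.integrableOn.congr_fun hfF hΩ.measurableSet, ?_⟩
  set a := ∑ i : Fin k, lam (Fin.castAdd m i)
  set b := ∑ i : Fin m, lam (Fin.natAdd k i)
  have hlam := hρ.eigenvalue_nonneg hfm hf hM hW
  have ha : 0 ≤ a := Finset.sum_nonneg fun i _ => hlam _
  have hb : 0 ≤ b := Finset.sum_nonneg fun i _ => hlam _
  have hε0 : 0 ≤ ε := (norm_nonneg _).trans hWW'
  set J := c * (ε ^ 2 * a + b)
  have hJ0 : 0 ≤ J := by positivity
  set g := sampleMean ρ W' Z F with hg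
  have hgm := measurable_sampleMean hΩ hW' hS hF
  have hg0 : ∀ ω x, 0 ≤ g ω x := fun ω x =>
    mul_nonneg (by positivity) (Finset.sum_nonneg fun j _ => hF0 _)
  have hmean : ∫⁻ ω, (∫⁻ x, ENNReal.ofReal ((F x - g ω x) ^ 2 * ρ x)) ∂P ≤ ENNReal.ofReal J := by
    refine (lintegral_sampleMean_le hN hΩ hρm hρ.nonneg hW' hS hF).trans ?_
    refine (lintegral_condLaw_le hW' hρm hρ.nonneg (hB W' hW') hF
      (measurable_gradOn hΩ hfm hf) (hρ.ae_path hf0 hfm hf)).trans ?_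
    rw [hcK, ENNReal.ofReal_mul hc0]
    exact mul_le_mul_right (hρ.lintegral_norm_inactiveVar_gradOn_le hfm hf hM hW hW' hWW') _
  have hcongr : ∀ᵐ ω ∂P, hellingerDist (ActiveSubspace.posterior ρ F)
      (ActiveSubspace.posterior ρ (g ω)) = hellingerDist (ActiveSubspace.posterior ρ f)
      (ActiveSubspace.posterior ρ (monteCarloApprox f W' Z ω)) := by
    filter_upwards [ae_posterior_monteCarloApprox_eq (f := f) hΩ hρm hρ.nonneg hW' hS] with ω hω
    rw [hellingerDist, hellingerDist, hpost]
    congr 2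
    refine integral_congr_ae ?_
    filter_upwards [hω] with x hx
    rw [hx]
  have hL := hellingerConst_nonneg ρ F
  obtain ⟨hint, hle⟩ := hρ.integral_hellingerDist_posterior_le hF hF0 hFρ hgm hg0 hJ0 hmean
  refine ⟨hint.congr hcongr, ?_⟩
  rw [← integral_congr_ae hcongr, hconst]
  refine hle.trans ?_
  have hNp : 0 ≤ (N : ℝ) ^ (-(1 / 2) : ℝ) := by positivity
  have hsqrt : √8 * √J ≤ √(8 * c + 1) * (ε * √a + √b) := by
    rw [← Real.sqrt_mul (by norm_num)]
    refine Real.sqrt_le_iff.2 ⟨by positivity, ?_⟩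
    rw [mul_pow, Real.sq_sqrt (by positivity)]
    have h1 : ε ^ 2 * a + b ≤ (ε * √a + √b) ^ 2 := by
      have h2 : 0 ≤ ε * √a * √b := by positivity
      nlinarith [Real.sq_sqrt ha, Real.sq_sqrt hb]
    calc 8 * J = 8 * c * (ε ^ 2 * a + b) := by ring
      _ ≤ (8 * c + 1) * (ε * √a + √b) ^ 2 := by
          gcongr
          linarith
  calc √8 * hellingerConst ρ F * √J = hellingerConst ρ F * (√8 * √J) := by ring
    _ ≤ hellingerConst ρ F * (√(8 * c + 1) * (ε * √a + √b)) := by gcongr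
    -- The bound already holds without the sampling factor, which is at least `1`.
    _ ≤ hellingerConst ρ F * (√(8 * c + 1) * (ε * √a + √b)) * (1 + (N : ℝ) ^ (-(1 / 2) : ℝ)) :=
        le_mul_of_one_le_right (by positivity) (by linarith)
    _ = _ := by ring
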